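/- Consider $M$ mutually independent request flows sharing one cache. Flow $k$ ($1\le k\le M$) has Poisson arrivals of rate $\lambda_k>0$, and its requests are i.i.d. The data items requested by the flows are $d_i$, $i\ge 1$, of sizes $s_i\ge 0$ with $\sup_i s_i<\infty$; different flows may request the same items. Put $\nu_k=\lambda_k/\sum_j\lambda_j$, and let $p^\circ_i=\sum_j \nu_j\,\mathbb P[\text{a request of flow } j \text{ is for } d_i]$ be the probability that a request of the mixed flow is for $d_i$. Let $$m(z)=\sum_i s_i\bigl(1-(1-p^\circ_i)^z\bigr),\qquad z\ge 0,$$ assume $m(z)\to\infty$ as $z\to\infty$, and let $m^\leftarrow$ be the inverse function of $m$. In the move-to-front list, the items are sorted by the time elapsed since their last request (by any flow). For a request at time $0$ in stationarity, let $I_0$ be the flow that issues it, let $R_0$ be the requested item, and let $C_0$ be the total size of the items that are in front of $R_0$ in the list just before time $0$; with an LRU cache of capacity $x$ the request is a miss if $C_0>x$. Assume that there are functions $\delta:(0,\infty)\to(0,1]$ and $f$ with $\lim_{\epsilon\downarrow 0}f(\epsilon)=1$ such that, for all sufficiently small $\epsilon>0$, $$\lim_{x\to\infty}\frac{m^\leftarrow((1+\epsilon\delta(x))x)}{m^\leftarrow(x)}=f(\epsilon),$$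 and there exist $h_2>h_1>0$, $h_4>h_3>0$ and $x_0$ with $$h_1<\frac{\delta(x)}{\delta(x+\epsilon\delta(x))}<h_2,\qquad h_3<\frac{\delta(x-\epsilon\delta(x))}{\delta(x)}<h_4\qquad\text{for all } x>x_0.$$ Assume moreover that $\varlimsup_{x\to\infty}\log(m^\leftarrow(x))/(\delta^2(x)\,x)=0$. Fix a flow $k$. Let $d^{(k)}_1,d^{(k)}_2,\dots$ be a list of the (infinitely many) distinct items of flow $k$, with $q^{(k)}_i=\mathbb P[R_0=d^{(k)}_i\mid I_0=k]$ and $p^{(k)}_i=\mathbb P[R_0=d^{(k)}_i]$, ordered such that $p^{(k)}_i$ is non-increasing in $i$. Assume $\lim_{n\to\infty}q^{(k)}_n/q^{(k)}_{n+1}=1$, and that for a function $\Phi_k$ defined in a neighborhood of infinity $$\Bigl(\sum_{i\ge y}q^{(k)}_i\Bigr)^{-1}\sim\Phi_k\bigl(1/p^{(k)}_y\bigr)\quad(y\to\infty),\qquad \Phi_k(x)\sim x^{\beta_k}l_k(x)\quad(x\to\infty),$$ where $\beta_k\ge 0$ and $l_k$ is slowly varying, i.e. measurable and positive near infinity with $l_k(\lambda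 x)/l_k(x)\to1$ for every $\lambda>0$; if $\beta_k=0$, assume also that $l_k$ is eventually non-decreasing. Then, as $x\to\infty$, $$\mathbb P[C_0>x\mid I_0=k]\sim\frac{\Gamma(\beta_k+1)}{\Phi_k(m^\leftarrow(x))}.$$ -/

import Mathlib

open Filter Topology Asymptotics MeasureTheory ProbabilityTheory
open scoped ENNReal

noncomputable section

/-- `M` request flows sharing one cache. The data items requested by the entirety of the flows are
`d_0, d_1, d_2, …`, represented by their indices in `ℕ`; item `i` has size `size i`. Flow `k` has
Poisson arrivals of rate `rate k`, and its requests are i.i.d. with law `pop k` on the items.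
Different flows may request the same items. -/
structure CacheSystem (M : ℕ) where
  /-- the Poisson arrival rates -/
  rate : Fin M → ℝ
  rate_pos : ∀ k, 0 < rate k
  /-- the popularity distributions of the flows -/
  pop : Fin M → PMF ℕ
  /-- the sizes of the data items -/
  size : ℕ → ℝ
  size_nonneg : ∀ i, 0 ≤ size i
  size_bdd : BddAbove (Set.range size)

namespace CacheSystem

variable {M : ℕ} (S : CacheSystem M)

/-- `ν_k`, the probability that a request of the mixed flow originates from flow `k`. -/
def flowProb (k : Fin M) : ℝ := S.rate k / ∑ j, S.rate j

/-- The conditional probability that a request of flow `k` is for item `d`. -/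
def condProb (k : Fin M) (d : ℕ) : ℝ := (S.pop k d).toReal

/-- `p°_d`, the probability that a request of the mixed flow is for item `d`. -/
def mixedProb (d : ℕ) : ℝ := ∑ j, S.flowProb j * S.condProb j d

/-! ### The request process -/

/-- The request process seen from the request at time `0`. The first component is `(I_0, R_0)`:
the flow that issues the request at time `0` and the item requested. The second component
describes the requests before time `0`: `(ω.2 j n).2` is the item of the `(n+1)`-st last request of
flow `j` before time `0`, and `(ω.2 j n).1` is the time between this request and the next later
request of flow `j` (or time `0`, if `n = 0`). -/
abbrev Config (M : ℕ) : Type := (Fin M × ℕ) × (Fin M → ℕ → ℝ × ℕ)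

/-- The law of `(I_0, R_0)`. -/
def currentLaw : Measure (Fin M × ℕ) :=
  ∑ k, ENNReal.ofReal (S.flowProb k) • (Measure.dirac k).prod (S.pop k).toMeasure

/-- The law of the past of flow `k`: a Poisson process of rate `rate k` on `(-∞, 0)` (its gaps are
i.i.d. exponential) whose points carry independent items that are i.i.d. of law `pop k`. -/
def pastLaw (k : Fin M) : Measure (ℕ → ℝ × ℕ) :=
  Measure.infinitePi fun _ : ℕ => (expMeasure (S.rate k)).prod (S.pop k).toMeasure

/-- The law of the request process seen from a request at time `0`: the flows are
mutually independent, and the past of the Poisson flows is independent of `(I_0, R_0)`. -/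
def law : Measure (Config M) :=
  S.currentLaw.prod (Measure.pi fun k => S.pastLaw k)

/-- `I_0`, the flow that issues the request at time `0`. -/
def flowAtZero (ω : Config M) : Fin M := ω.1.1

/-- `R_0`, the item requested at time `0`. -/
def itemAtZero (ω : Config M) : ℕ := ω.1.2

/-- The time elapsed at time `0` since the `(n+1)`-st last request of flow `j`. -/
def age (ω : Config M) (j : Fin M) (n : ℕ) : ℝ := ∑ i ∈ Finset.range (n + 1), (ω.2 j i).1

/-- The time elapsed at time `0` since the last request for item `d` by any of the flows
(`∞` if `d` has never been requested). -/
def lastAge (ω : Config M) (d : ℕ) : ℝ≥0∞ :=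
  ⨅ (j : Fin M) (n : ℕ) (_ : (ω.2 j n).2 = d), ENNReal.ofReal (age ω j n)

open scoped Classical in
/-- `C_0`. In the move-to-front list the items are sorted by the time elapsed since their last
request; `C_0` is the total size of the items in front of the item `R_0`. A request at time `0`
is a miss in an LRU cache of capacity `x` if `C_0 > x`. -/
def searchCost (ω : Config M) : ℝ≥0∞ :=
  ∑' d : ℕ, if lastAge ω d < lastAge ω (itemAtZero ω) then ENNReal.ofReal (S.size d) else 0

/-- `P[C_0 > x | I_0 = k]`, the miss probability of flow `k` for a cache of capacity `x`. -/
def missProb (k : Fin M) (x : ℝ) : ℝ :=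
  (cond S.law {ω | flowAtZero ω = k}).real {ω | ENNReal.ofReal x < S.searchCost ω}

/-! ### The characteristics of the flows -/

/-- `m(z) = ∑ s_i (1 - (1 - p°_i)^z)`. -/
def m (z : ℝ) : ℝ := ∑' i, S.size i * (1 - (1 - S.mixedProb i) ^ z)

/-- The inverse `m^←` on `[0, ∞)` of the increasing function `m`. -/
def mInv (x : ℝ) : ℝ := sInf {z | 0 ≤ z ∧ x ≤ S.m z}

/-- `e` lists the items of flow `k` (each of them once) such that their request probabilities
in the mixed flow are non-increasing. Thus `e i` is the item `d^(k)_i`. -/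
structure IsRanking (k : Fin M) (e : ℕ → ℕ) : Prop where
  injective : Function.Injective e
  support_subset : (S.pop k).support ⊆ Set.range e
  antitone : Antitone fun i => S.mixedProb (e i)

end CacheSystem

/-- Slowly varying functions (at infinity). -/
structure SlowlyVarying (l : ℝ → ℝ) : Prop where
  measurable : Measurable l
  eventually_pos : ∀ᶠ x in atTop, 0 < l x
  tendsto : ∀ c : ℝ, 0 < c → Tendsto (fun x => l (c * x) / l x) atTop (𝓝 1)

end

/-!
A request for item `r` is a miss if the items requested since the last request for `r` have total
size above `x`. In a time in which `τ` requests of the mixed flow are expected, the total size of the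
requested items has mean `expectedSeen τ`, which differs from `m τ` by at most a constant, and it is
so concentrated that the request is a miss essentially if and only if `r` has not been requested
for a time corresponding to `τ = m⁻¹ x`. Hence the miss probability of flow `k` is asymptotic to
`unseenProb k τ = ∑ q_r exp (-τ p_r)` at `τ = m⁻¹ x`, and an Abelian theorem evaluates this Laplace
transform as `Γ(β + 1) / Φ(τ)`.

*Probability.* For a set `B` of items, the requests of a flow for items in `B` satisfy a renewal
equation whose solution is exponential (`markedPoisson_noMarkBefore`). The product over the flows
shows that the events "`d` has not been requested within time `t`" are independent with probability
`exp (-τ p_d)` (`past_biInter_unseen`, `iIndepSet_unseen`). Chernoff bounds for the total size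
follow, and comparing the event of a miss with the event that `r` has not been seen within a
deterministic time `t` sandwiches the miss probability (`missProb_le`, `le_missProb`); no
conditioning on the time of the last request is needed.

*Concentration.* The hypotheses on `m⁻¹` imply that replacing `τ` by `(1 + η) τ` increases `m τ` by
more than any multiple of `√(m τ log τ)` (`eventually_m_add_sqrt_le`). So the Chernoff bounds are
smaller than every power of `τ`, while `1 / Φ(τ)` decays at most like a power.

*Analysis.* The uniform convergence theorem for slowly varying functions gives the Potter bounds, and
with them that `Φ` is asymptotically nondecreasing (`RegularGrowth`). Since consecutive `q_i` are
asymptotically equal, the relation between `Φ` and the tails extends from the arguments `1 / p_y` to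
all arguments (`tendsto_mul_unpopularMass`), and dominated convergence gives the Abelian theorem
(`tendsto_mul_tsum_exp`).
-/

noncomputable section

/-! ### Slowly and regularly varying functions -/

theorem eventually_lt_volume_forall_abs_sub_lt {h : ℝ → ℝ}
    (hh : ∀ u, Tendsto (fun x => h (x + u) - h x) atTop (𝓝 0)) {ε : ℝ} (hε : 0 < ε)
    {y : ℕ → ℝ} (hy : Tendsto y atTop atTop) :
    ∀ᶠ n : ℕ in atTop, ENNReal.ofReal (3 / 2) <
      volume {v | v ∈ Set.Icc (0 : ℝ) 2 ∧ ∀ m, n ≤ m → |h (y m + v) - h (y m)| < ε} := by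
  have hmono : Monotone fun n : ℕ =>
      {v | v ∈ Set.Icc (0 : ℝ) 2 ∧ ∀ m, n ≤ m → |h (y m + v) - h (y m)| < ε} :=
    fun a b hab v hv => ⟨hv.1, fun m hm => hv.2 m (hab.trans hm)⟩
  have hU : (⋃ n : ℕ, {v | v ∈ Set.Icc (0 : ℝ) 2 ∧ ∀ m, n ≤ m → |h (y m + v) - h (y m)| < ε})
      = Set.Icc 0 2 := by
    ext v
    simp only [Set.mem_iUnion, Set.mem_ofPred_eq]
    refine ⟨fun ⟨n, hn⟩ => hn.1, fun hv => ?_⟩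
    have h1 := ((hh v).comp hy).eventually (Metric.ball_mem_nhds 0 hε)
    obtain ⟨n, hn⟩ := eventually_atTop.1 h1
    refine ⟨n, hv, fun m hm => ?_⟩
    simpa [Real.dist_eq] using hn m hm
  have ht := tendsto_measure_iUnion_atTop (μ := (volume : Measure ℝ)) hmono
  rw [hU, Real.volume_Icc] at ht
  refine ht.eventually (lt_mem_nhds ?_)
  rw [ENNReal.ofReal_lt_ofReal_iff] <;> norm_num

/-- The uniform convergence theorem for slowly varying functions, in additive form
(the argument of Csiszár and Erdős). -/
theorem eventually_forall_abs_sub_le {h : ℝ → ℝ} (hmeas : Measurable h)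
    (hh : ∀ u, Tendsto (fun x => h (x + u) - h x) atTop (𝓝 0)) {ε : ℝ} (hε : 0 < ε) :
    ∀ᶠ x in atTop, ∀ u ∈ Set.Icc (0 : ℝ) 1, |h (x + u) - h x| ≤ ε := by
  by_contra hcon
  have hfr : ∀ n : ℕ, ∃ x : ℝ, (n : ℝ) ≤ x ∧ ∃ u ∈ Set.Icc (0 : ℝ) 1, ε < |h (x + u) - h x| := by
    intro n
    obtain ⟨x, hx, hx2⟩ := (frequently_atTop.1 (not_eventually.1 hcon)) (n : ℝ)
    push Not at hx2
    exact ⟨x, hx, hx2⟩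
  choose x hx u hu hxu using hfr
  have hxt : Tendsto x atTop atTop := tendsto_atTop_mono hx tendsto_natCast_atTop_atTop
  have hyt : Tendsto (fun n => x n + u n) atTop atTop :=
    tendsto_atTop_mono (fun n => by linarith [(hu n).1]) hxt
  obtain ⟨n, hn1, hn2⟩ := ((eventually_lt_volume_forall_abs_sub_lt hh (half_pos hε) hxt).and
    (eventually_lt_volume_forall_abs_sub_lt hh (half_pos hε) hyt)).exists
  set A := {v | v ∈ Set.Icc (0 : ℝ) 2 ∧ ∀ m, n ≤ m → |h (x m + v) - h (x m)| < ε / 2} with hA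
  set B := {v | v ∈ Set.Icc (0 : ℝ) 2 ∧
    ∀ m, n ≤ m → |h (x m + u m + v) - h (x m + u m)| < ε / 2} with hB
  have hBm : MeasurableSet B := by
    rw [hB]
    refine measurableSet_Icc.inter ?_
    change MeasurableSet {v | ∀ m, n ≤ m → |h (x m + u m + v) - h (x m + u m)| < ε / 2}
    rw [Set.ofPred_forall]
    refine MeasurableSet.iInter fun m => ?_
    rw [Set.ofPred_forall]
    refine MeasurableSet.iInter fun _ => ?_
    exact measurableSet_lt (by fun_prop) measurable_const
  -- two sets of measure above `3 / 2` inside `[0, 3]` meet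
  have hne : (A ∩ (fun w => w + -u n) ⁻¹' B).Nonempty := by
    refine nonempty_inter_of_measure_lt_add (volume : Measure ℝ) (u := Set.Icc 0 3)
      (hBm.preimage (by fun_prop)) ?_ ?_ ?_
    · exact fun v hv => ⟨hv.1.1, by linarith [hv.1.2]⟩
    · intro v hv
      have h1 := hv.1.1
      have h2 := hv.1.2
      have h3 := hu n
      constructor <;> linarith [h3.1, h3.2]
    · rw [measure_preimage_add_right, Real.volume_Icc]
      calc ENNReal.ofReal (3 - 0) = ENNReal.ofReal (3 / 2) + ENNReal.ofReal (3 / 2) := by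
            rw [← ENNReal.ofReal_add] <;> norm_num
        _ < _ := ENNReal.add_lt_add hn1 hn2
  obtain ⟨w, hwA, hwB⟩ := hne
  have h1 := hwA.2 n le_rfl
  have h2 := hwB.2 n le_rfl
  have h3 := hxu n
  rw [show x n + u n + (w + -u n) = x n + w by ring] at h2
  have h4 : |h (x n + u n) - h (x n)|
      ≤ |h (x n + w) - h (x n)| + |h (x n + w) - h (x n + u n)| := by
    have := abs_sub (h (x n + w) - h (x n)) (h (x n + w) - h (x n + u n))
    rwa [show h (x n + w) - h (x n) - (h (x n + w) - h (x n + u n))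
      = h (x n + u n) - h (x n) by ring] at this
  linarith

theorem abs_sub_le_mul_add_one {h : ℝ → ℝ} {ε X : ℝ} (hε : 0 ≤ ε)
    (hX : ∀ x, X ≤ x → ∀ u ∈ Set.Icc (0 : ℝ) 1, |h (x + u) - h x| ≤ ε)
    {x u : ℝ} (hx : X ≤ x) (hu : 0 ≤ u) : |h (x + u) - h x| ≤ ε * (u + 1) := by
  have key : ∀ n : ℕ, ∀ u : ℝ, 0 ≤ u → u ≤ n → |h (x + u) - h x| ≤ ε * n := by
    intro n
    induction n with
    | zero =>
      intro u h0 h1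
      have : u = 0 := le_antisymm (by simpa using h1) h0
      simp [this]
    | succ n ih =>
      intro u h0 h1
      push_cast at h1 ⊢
      rcases le_total u 1 with h2 | h2
      · have := hX x hx u ⟨h0, h2⟩
        have h3 : 0 ≤ ε * n := by positivity
        linarith
      · have h3 := ih (u - 1) (by linarith) (by linarith)
        have h4 := hX (x + (u - 1)) (by linarith) 1 ⟨zero_le_one, le_rfl⟩
        rw [show x + (u - 1) + 1 = x + u by ring] at h4
        have := abs_sub_le (h (x + u)) (h (x + (u - 1))) (h x)
        linarith
  refine (key ⌈u⌉₊ u hu (Nat.le_ceil u)).trans ?_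
  exact mul_le_mul_of_nonneg_left (Nat.ceil_lt_add_one hu).le hε

namespace SlowlyVarying

/-- The Potter bounds. -/
theorem exists_potter {l : ℝ → ℝ} (hl : SlowlyVarying l) {a : ℝ} (ha : 0 < a) :
    ∃ X : ℝ, 1 ≤ X ∧ ∀ x y, X ≤ x → x ≤ y → 0 < l x ∧
      l y ≤ Real.exp a * (y / x) ^ a * l x ∧ l x ≤ Real.exp a * (y / x) ^ a * l y := by
  set h : ℝ → ℝ := fun u => Real.log (l (Real.exp u)) with hh
  have hmeas : Measurable h := Real.measurable_log.comp (hl.measurable.comp Real.measurable_exp)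
  have hlim : ∀ u, Tendsto (fun x => h (x + u) - h x) atTop (𝓝 0) := by
    intro u
    have h1 := (hl.tendsto (Real.exp u) (Real.exp_pos u)).comp Real.tendsto_exp_atTop
    have h2 := ((Real.continuousAt_log one_ne_zero).tendsto.comp h1)
    rw [Real.log_one] at h2
    refine h2.congr' ?_
    have hp := Real.tendsto_exp_atTop.eventually hl.eventually_pos
    have hp2 := (tendsto_atTop_add_const_right atTop u tendsto_id).eventually hp
    filter_upwards [hp, hp2] with x hx hx2
    simp only [Function.comp, id, hh] at hx hx2 ⊢
    rw [← Real.exp_add, add_comm u x, Real.log_div hx2.ne' hx.ne']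
  obtain ⟨X₁, hX₁⟩ := eventually_atTop.1 (eventually_forall_abs_sub_le hmeas hlim ha)
  obtain ⟨X₂, hX₂⟩ := eventually_atTop.1 hl.eventually_pos
  refine ⟨max 1 (max X₂ (Real.exp X₁)), le_max_left _ _, fun x y hx hxy => ?_⟩
  simp only [max_le_iff] at hx
  have hx0 : 0 < x := by linarith
  have hy0 : 0 < y := by linarith
  have hlx := hX₂ x hx.2.1
  have hly := hX₂ y (hx.2.1.trans hxy)
  have hlogx : X₁ ≤ Real.log x := (Real.le_log_iff_exp_le hx0).2 hx.2.2
  have h1 : 1 ≤ y / x := (one_le_div hx0).2 hxy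
  have h2 := abs_sub_le_mul_add_one ha.le hX₁ hlogx (Real.log_nonneg h1)
  have h3 : Real.log x + Real.log (y / x) = Real.log y := by
    rw [Real.log_div hy0.ne' hx0.ne']; ring
  rw [h3] at h2
  simp only [hh, Real.exp_log hx0, Real.exp_log hy0] at h2
  have h4 : Real.exp a * (y / x) ^ a = Real.exp (a * (Real.log (y / x) + 1)) := by
    rw [Real.rpow_def_of_pos (by positivity), ← Real.exp_add]; ring_nf
  refine ⟨hlx, ?_, ?_⟩
  · rw [h4, ← Real.log_le_log_iff hly (by positivity), Real.log_mul (Real.exp_ne_zero _) hlx.ne',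
      Real.log_exp]
    linarith [(abs_le.1 h2).2]
  · rw [h4, ← Real.log_le_log_iff hlx (by positivity), Real.log_mul (Real.exp_ne_zero _) hly.ne',
      Real.log_exp]
    linarith [(abs_le.1 h2).1]

end SlowlyVarying

/-- The properties of a regularly varying function `Φ` of index `β ≥ 0` that the asymptotics of the
miss probability rest on. `almost_mono` says that `Φ` is asymptotically equivalent to a
nondecreasing function; for `β = 0` it does not follow from regular variation. -/
structure RegularGrowth (Φ : ℝ → ℝ) (β : ℝ) : Prop where
  eventually_pos : ∀ᶠ x in atTop, 0 < Φ x
  tendsto : ∀ c : ℝ, 0 < c → Tendsto (fun x => Φ (c * x) / Φ x) atTop (𝓝 (c ^ β))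
  almost_mono : ∀ ε : ℝ, 0 < ε → ∃ X : ℝ, ∀ x y, X ≤ x → x ≤ y → Φ x ≤ (1 + ε) * Φ y
  potter : ∃ C X : ℝ, 0 < C ∧ 1 ≤ X ∧
    ∀ x y, X ≤ x → x ≤ y → 0 < Φ x ∧ Φ y ≤ C * (y / x) ^ (β + 1) * Φ x

theorem SlowlyVarying.almost_mono_rpow_mul {l : ℝ → ℝ} (hl : SlowlyVarying l) {β : ℝ} (hβ : 0 ≤ β)
    (hβ_zero : β = 0 → ∃ x₀, MonotoneOn l (Set.Ici x₀)) {ε : ℝ} (hε : 0 < ε) :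
    ∃ X : ℝ, ∀ x y, X ≤ x → x ≤ y → x ^ β * l x ≤ (1 + ε) * (y ^ β * l y) := by
  rcases hβ.eq_or_lt with h0 | h0
  · obtain ⟨x₀, hx₀⟩ := hβ_zero h0.symm
    obtain ⟨X, hX⟩ := eventually_atTop.1 hl.eventually_pos
    refine ⟨max x₀ X, fun x y hx hxy => ?_⟩
    simp only [max_le_iff] at hx
    have h1 := hx₀ hx.1 (hx.1.trans hxy : x₀ ≤ y) hxy
    have h2 := hX y (hx.2.trans hxy)
    rw [← h0, Real.rpow_zero, Real.rpow_zero]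
    nlinarith
  · -- a Potter exponent below `β` makes the power of `y / x` win
    set a := min β (Real.log (1 + ε)) with ha
    have ha0 : 0 < a := lt_min h0 (Real.log_pos (by linarith))
    obtain ⟨X, hX1, hX⟩ := hl.exists_potter ha0
    refine ⟨X, fun x y hx hxy => ?_⟩
    have hx0 : 0 < x := by linarith
    have hy0 : 0 < y := by linarith
    obtain ⟨-, -, h1⟩ := hX x y hx hxy
    have hly := (hX y y (hx.trans hxy) le_rfl).1
    have h2 : Real.exp a ≤ 1 + ε := by
      rw [← Real.le_log_iff_exp_le (by linarith)]; exact min_le_right _ _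
    have h3 : (y / x) ^ a ≤ (y / x) ^ β :=
      Real.rpow_le_rpow_of_exponent_le ((one_le_div hx0).2 hxy) (min_le_left _ _)
    calc x ^ β * l x ≤ x ^ β * ((1 + ε) * (y / x) ^ β * l y) := by
          refine mul_le_mul_of_nonneg_left (h1.trans ?_) (by positivity)
          gcongr
      _ = (1 + ε) * (y ^ β * l y) := by
          rw [Real.div_rpow hy0.le hx0.le]
          field_simp

theorem RegularGrowth.of_isEquivalent {Φ l : ℝ → ℝ} {β : ℝ} (hβ : 0 ≤ β) (hl : SlowlyVarying l)
    (hΦl : Φ ~[atTop] fun x => x ^ β * l x)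
    (hβ_zero : β = 0 → ∃ x₀, MonotoneOn l (Set.Ici x₀)) : RegularGrowth Φ β := by
  have hRpos : ∀ᶠ x in atTop, 0 < x ^ β * l x := by
    filter_upwards [hl.eventually_pos, eventually_gt_atTop 0] with x h1 h2
    positivity
  have hratio : Tendsto (fun x => Φ x / (x ^ β * l x)) atTop (𝓝 1) :=
    (isEquivalent_iff_tendsto_one (hRpos.mono fun x hx => hx.ne')).1 hΦl
  have hbd : ∀ η : ℝ, 0 < η → ∀ᶠ x in atTop,
      (1 - η) * (x ^ β * l x) ≤ Φ x ∧ Φ x ≤ (1 + η) * (x ^ β * l x) := by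
    intro η hη
    filter_upwards [hRpos, hratio.eventually (Icc_mem_nhds (by linarith : 1 - η < 1)
      (by linarith : 1 < 1 + η))] with x h1 h2
    exact ⟨(le_div_iff₀ h1).1 h2.1, (div_le_iff₀ h1).1 h2.2⟩
  have hpos : ∀ᶠ x in atTop, 0 < Φ x := by
    filter_upwards [hbd (1 / 2) (by norm_num), hRpos] with x h1 h2
    linarith [h1.1]
  refine ⟨hpos, ?_, ?_, ?_⟩
  · intro c hc
    have hcx : Tendsto (fun x : ℝ => c * x) atTop atTop := tendsto_id.const_mul_atTop hc
    have h1 := ((hratio.comp hcx).div hratio one_ne_zero).mul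
      ((hl.tendsto c hc).const_mul (c ^ β))
    simp only [div_one, one_mul, mul_one] at h1
    refine h1.congr' ?_
    filter_upwards [hRpos, hcx.eventually hRpos, hpos, eventually_gt_atTop 0,
      hl.eventually_pos, hcx.eventually hl.eventually_pos] with x h2 h3 h4 h5 h6 h7
    simp only [Function.comp, Pi.div_apply]
    rw [Real.mul_rpow hc.le h5.le]
    field_simp
  · intro ε hε
    set η := min (ε / 8) (1 / 2) with hηd
    have hη : 0 < η := lt_min (by linarith) (by norm_num)
    have hη1 : η ≤ ε / 8 := min_le_left _ _
    have hη2 : η ≤ 1 / 2 := min_le_right _ _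
    obtain ⟨X, hX⟩ := hl.almost_mono_rpow_mul hβ hβ_zero hη
    obtain ⟨Y, hY⟩ := eventually_atTop.1 ((hbd η hη).and hRpos)
    refine ⟨max X Y, fun x y hx hxy => ?_⟩
    simp only [max_le_iff] at hx
    have h1 := hX x y hx.1 hxy
    obtain ⟨⟨-, h2⟩, h5⟩ := hY x hx.2
    obtain ⟨⟨h3, -⟩, h4⟩ := hY y (hx.2.trans hxy)
    set R := y ^ β * l y
    have h6 : (1 + η) * ((1 + η) * R) ≤ (1 + ε) * ((1 - η) * R) := by
      have h7 : (1 + η) * (1 + η) ≤ (1 + ε) * (1 - η) := by nlinarith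
      calc (1 + η) * ((1 + η) * R) = ((1 + η) * (1 + η)) * R := by ring
        _ ≤ ((1 + ε) * (1 - η)) * R := mul_le_mul_of_nonneg_right h7 h4.le
        _ = _ := by ring
    calc Φ x ≤ (1 + η) * (x ^ β * l x) := h2
      _ ≤ (1 + η) * ((1 + η) * R) := by gcongr
      _ ≤ (1 + ε) * ((1 - η) * R) := h6
      _ ≤ (1 + ε) * Φ y := by gcongr
  · obtain ⟨X, hX1, hX⟩ := hl.exists_potter one_pos
    obtain ⟨Y, hY⟩ := eventually_atTop.1 ((hbd (1 / 2) (by norm_num)).and hpos)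
    refine ⟨3 * Real.exp 1, max X Y, by positivity, hX1.trans (le_max_left _ _),
      fun x y hx hxy => ?_⟩
    simp only [max_le_iff] at hx
    have hx0 : 0 < x := by linarith
    have hy0 : 0 < y := by linarith
    obtain ⟨h0, h1, -⟩ := hX x y hx.1 hxy
    obtain ⟨⟨h2, -⟩, h5⟩ := hY x hx.2
    obtain ⟨⟨-, h3⟩, h4⟩ := hY y (hx.2.trans hxy)
    refine ⟨h5, ?_⟩
    have h6 : y ^ β = (y / x) ^ β * x ^ β := by
      rw [Real.div_rpow hy0.le hx0.le]; field_simp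
    calc Φ y ≤ (1 + 1 / 2) * (y ^ β * (Real.exp 1 * (y / x) ^ (1 : ℝ) * l x)) := by
          refine h3.trans ?_
          gcongr
      _ = 3 * Real.exp 1 * (y / x) ^ (β + 1) * ((1 - 1 / 2) * (x ^ β * l x)) := by
          rw [Real.rpow_add (by positivity), h6]; ring
      _ ≤ _ := by gcongr

theorem RegularGrowth.tendsto_mul_rpow_neg {Φ : ℝ → ℝ} {β : ℝ} (hΦ : RegularGrowth Φ β) :
    Tendsto (fun x => Φ x * x ^ (-(β + 2))) atTop (𝓝 0) := by
  obtain ⟨C, X, hC, hX, hpot⟩ := hΦ.potter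
  have hX0 : 0 < X := by linarith
  have hΦX := (hpot X X le_rfl le_rfl).1
  have h1 : Tendsto (fun x : ℝ => C * Φ X * X ^ (-(β + 1)) * x⁻¹) atTop (𝓝 0) := by
    simpa using tendsto_inv_atTop_zero.const_mul (C * Φ X * X ^ (-(β + 1)))
  refine squeeze_zero' ?_ ?_ h1
  · filter_upwards [hΦ.eventually_pos, eventually_gt_atTop 0] with x h2 h3
    positivity
  · filter_upwards [eventually_ge_atTop X] with x hx
    have hx0 : 0 < x := by linarith
    have h2 := (hpot X x le_rfl hx).2
    calc Φ x * x ^ (-(β + 2)) ≤ (C * (x / X) ^ (β + 1) * Φ X) * x ^ (-(β + 2)) := by gcongr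
      _ = C * Φ X * X ^ (-(β + 1)) * (x ^ (β + 1) * x ^ (-(β + 2))) := by
          rw [Real.div_rpow hx0.le hX0.le, Real.rpow_neg hX0.le]; ring
      _ = _ := by
          rw [← Real.rpow_add hx0, show β + 1 + -(β + 2) = -1 by ring, Real.rpow_neg_one]

theorem RegularGrowth.tendsto_mul_comp_const_mul {Φ W : ℝ → ℝ} {β G : ℝ} (hΦ : RegularGrowth Φ β)
    (hW : Tendsto (fun τ => Φ τ * W τ) atTop (𝓝 G)) {c : ℝ} (hc : 0 < c) :
    Tendsto (fun x => Φ x * W (c * x)) atTop (𝓝 (G * (c ^ β)⁻¹)) := by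
  have hcx : Tendsto (fun x : ℝ => c * x) atTop atTop := tendsto_id.const_mul_atTop hc
  refine ((hW.comp hcx).mul ((hΦ.tendsto c hc).inv₀ (Real.rpow_pos_of_pos hc β).ne')).congr' ?_
  filter_upwards [hΦ.eventually_pos, hcx.eventually hΦ.eventually_pos] with x h1 h2
  simp only [Function.comp]
  field_simp

theorem RegularGrowth.tendsto_mul_rpow_neg_const_mul {Φ : ℝ → ℝ} {β : ℝ} (hΦ : RegularGrowth Φ β)
    {c : ℝ} (hc : 0 < c) (b : ℝ) :
    Tendsto (fun x => Φ x * (b * (c * x) ^ (-(β + 2)))) atTop (𝓝 0) := by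
  have h := hΦ.tendsto_mul_rpow_neg.mul_const (b * c ^ (-(β + 2)))
  rw [zero_mul] at h
  refine h.congr' ?_
  filter_upwards [eventually_gt_atTop 0] with x hx
  rw [Real.mul_rpow hc.le hx.le]
  ring

/-! ### Tails of a popularity distribution and their Laplace transform -/

theorem tendsto_shift_div_of_tendsto_div_succ {q : ℕ → ℝ}
    (hclass : Tendsto (fun n => q n / q (n + 1)) atTop (𝓝 1)) (hq : ∀ᶠ n in atTop, q n ≠ 0)
    (j : ℕ) : Tendsto (fun n => q (n + j) / q n) atTop (𝓝 1) := by
  induction j with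
  | zero =>
    refine tendsto_const_nhds.congr' ?_
    filter_upwards [hq] with n hn
    rw [add_zero, div_self hn]
  | succ j ih =>
    have h1 := (hclass.comp (tendsto_add_atTop_nat j)).inv₀ one_ne_zero
    have h2 := ih.mul h1
    rw [inv_one, mul_one] at h2
    refine h2.congr' ?_
    filter_upwards [(tendsto_add_atTop_nat j).eventually hq] with n hn
    simp only [Function.comp]
    rw [inv_div, add_assoc]
    field_simp

theorem eventually_ne_zero_of_tendsto_div_succ {q : ℕ → ℝ}
    (hclass : Tendsto (fun n => q n / q (n + 1)) atTop (𝓝 1)) : ∀ᶠ n in atTop, q n ≠ 0 := by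
  filter_upwards [hclass.eventually (lt_mem_nhds (zero_lt_one))] with n hn h0
  simp [h0] at hn

/-- If consecutive terms are asymptotically equal, a single term is negligible against the tail. -/
theorem tendsto_tail_succ_div_tail {q : ℕ → ℝ} (hq0 : ∀ n, 0 ≤ q n) (hqs : Summable q)
    (hclass : Tendsto (fun n => q n / q (n + 1)) atTop (𝓝 1)) :
    Tendsto (fun y => (∑' i, q (y + 1 + i)) / ∑' i, q (y + i)) atTop (𝓝 1) := by
  have hne := eventually_ne_zero_of_tendsto_div_succ hclass
  have hsum : ∀ y, Summable fun i => q (y + i) := fun y => by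
    simpa only [add_comm] using (summable_nat_add_iff y).2 hqs
  have hsplit : ∀ y, ∑' i, q (y + i) = q y + ∑' i, q (y + 1 + i) := fun y => by
    rw [(hsum y).tsum_eq_zero_add, add_zero]
    congr 1
    exact tsum_congr fun i => by rw [add_assoc, add_comm i 1]
  have hzero : Tendsto (fun y => q y / ∑' i, q (y + i)) atTop (𝓝 0) := by
    refine tendsto_order.2 ⟨fun a ha => Eventually.of_forall fun y => ha.trans_le
      (div_nonneg (hq0 y) (tsum_nonneg fun i => hq0 _)), fun a ha => ?_⟩
    obtain ⟨K, hK⟩ := exists_nat_gt (1 / a)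
    have h1 : Tendsto (fun y => ∑ j ∈ Finset.range K, q (y + j) / q y) atTop (𝓝 (K : ℝ)) := by
      have := tendsto_finsetSum (Finset.range K)
        fun j _ => tendsto_shift_div_of_tendsto_div_succ hclass hne j
      simpa using this
    filter_upwards [h1.eventually (lt_mem_nhds hK), hne] with y hy hy0
    have hqy : 0 < q y := lt_of_le_of_ne (hq0 y) hy0.symm
    rw [← Finset.sum_div, lt_div_iff₀ hqy] at hy
    have h2 : ∑ j ∈ Finset.range K, q (y + j) ≤ ∑' i, q (y + i) :=
      (hsum y).sum_le_tsum _ fun i _ => hq0 _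
    have h3 := hy.trans_le h2
    have h4 : 0 < ∑' i, q (y + i) := lt_of_le_of_lt (by positivity) h3
    rw [div_lt_iff₀ h4]
    rw [div_mul_eq_mul_div, one_mul, div_lt_iff₀ ha] at h3
    linarith
  have h1 := (tendsto_const_nhds (x := (1 : ℝ))).sub hzero
  rw [sub_zero] at h1
  refine h1.congr' ?_
  filter_upwards [hne] with y hy0
  have hqy : 0 < q y := lt_of_le_of_ne (hq0 y) hy0.symm
  have h4 : 0 < ∑' i, q (y + i) := by
    rw [hsplit]; exact add_pos_of_pos_of_nonneg hqy (tsum_nonneg fun i => hq0 _)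
  rw [eq_div_iff h4.ne', sub_mul, div_mul_cancel₀ _ h4.ne', one_mul]
  linarith [hsplit y]

theorem tendsto_one_of_eventually_le_mul {ι : Type*} {L : Filter ι} {A B g : ι → ℝ}
    (hA : Tendsto A L (𝓝 1)) (hB : Tendsto B L (𝓝 1))
    (h : ∀ ε : ℝ, 0 < ε → ∀ᶠ x in L, B x ≤ (1 + ε) * g x ∧ g x ≤ (1 + ε) * A x) :
    Tendsto g L (𝓝 1) := by
  refine tendsto_order.2 ⟨fun a ha => ?_, fun b hb => ?_⟩
  · have ha2 : a * (1 + (1 - a)) < 1 := by nlinarith [mul_pos (sub_pos.2 ha) (sub_pos.2 ha)]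
    filter_upwards [h (1 - a) (by linarith), hB.eventually (lt_mem_nhds ha2)] with x h1 h2
    nlinarith [h1.1]
  · have h3 := (hA.const_mul (1 + (b - 1) / 2))
    rw [mul_one] at h3
    filter_upwards [h ((b - 1) / 2) (by linarith),
      h3.eventually (gt_mem_nhds (show 1 + (b - 1) / 2 < b by linarith))] with x h1 h2
    linarith [h1.2]

/-- The probability that a request is for an item of popularity at most `u`. -/
def unpopularMass (q p : ℕ → ℝ) (u : ℝ) : ℝ := ∑' i, if p i ≤ u then q i else 0

section UnpopularMass

variable {q p : ℕ → ℝ}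

theorem summable_unpopularMass (hq0 : ∀ n, 0 ≤ q n) (hqs : Summable q) (u : ℝ) :
    Summable fun i => if p i ≤ u then q i else 0 :=
  Summable.of_nonneg_of_le (fun i => by split_ifs <;> simp [hq0 i])
    (fun i => by split_ifs <;> simp [hq0 i]) hqs

theorem unpopularMass_nonneg (hq0 : ∀ n, 0 ≤ q n) (u : ℝ) : 0 ≤ unpopularMass q p u :=
  tsum_nonneg fun i => by split_ifs <;> simp [hq0 i]

theorem unpopularMass_le (hq0 : ∀ n, 0 ≤ q n) (hqs : Summable q) (u : ℝ) :
    unpopularMass q p u ≤ ∑' i, q i :=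
  (summable_unpopularMass hq0 hqs u).tsum_le_tsum (fun i => by split_ifs <;> simp [hq0 i]) hqs

theorem monotone_unpopularMass (hq0 : ∀ n, 0 ≤ q n) (hqs : Summable q) :
    Monotone (unpopularMass q p) := fun u v huv =>
  (summable_unpopularMass hq0 hqs u).tsum_le_tsum (fun i => by
    by_cases h : p i ≤ u
    · simp [h, h.trans huv]
    · simp only [h, if_false]
      split_ifs <;> simp [hq0 i]) (summable_unpopularMass hq0 hqs v)

theorem unpopularMass_eq_tail (hq0 : ∀ n, 0 ≤ q n) (hqs : Summable q) (hp : Antitone p) {u : ℝ}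
    {y : ℕ} (hy : p y ≤ u) (hlt : ∀ i < y, u < p i) :
    unpopularMass q p u = ∑' i, q (y + i) := by
  rw [unpopularMass, ← (summable_unpopularMass hq0 hqs u).sum_add_tsum_nat_add y,
    Finset.sum_eq_zero, zero_add]
  · refine tsum_congr fun i => ?_
    rw [if_pos ((hp (Nat.le_add_left y i)).trans hy), add_comm]
  · intro i hi
    rw [if_neg (not_le.2 (hlt i (Finset.mem_range.1 hi)))]

/-- The hypothesis on the tails extends from the popularities `p y` to all small arguments:
between two consecutive popularities both sides are almost constant. -/
theorem tendsto_mul_unpopularMass {Φ : ℝ → ℝ} {β : ℝ} (hΦ : RegularGrowth Φ β)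
    (hq0 : ∀ n, 0 ≤ q n) (hqs : Summable q)
    (hclass : Tendsto (fun n => q n / q (n + 1)) atTop (𝓝 1))
    (hp : Antitone p) (hp0 : ∀ n, 0 < p n) (hplim : Tendsto p atTop (𝓝 0))
    (htail : (fun y : ℕ => (∑' i, q (y + i))⁻¹) ~[atTop] fun y : ℕ => Φ ((p y)⁻¹)) :
    Tendsto (fun x => Φ x * unpopularMass q p x⁻¹) atTop (𝓝 1) := by
  have hex : ∀ x : ℝ, ∃ y, 0 < x → p y ≤ x⁻¹ := by
    intro x
    by_cases hx : 0 < x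
    · obtain ⟨y, hy⟩ := (hplim.eventually (gt_mem_nhds (inv_pos.2 hx))).exists
      exact ⟨y, fun _ => hy.le⟩
    · exact ⟨0, fun h => absurd h hx⟩
  set Y : ℝ → ℕ := fun x => sInf {y | 0 < x → p y ≤ x⁻¹} with hYdef
  have hY1 : ∀ x, 0 < x → p (Y x) ≤ x⁻¹ := fun x hx => (Nat.sInf_mem (hex x)) hx
  have hY2 : ∀ x, 0 < x → ∀ i < Y x, x⁻¹ < p i := fun x hx i hi => by
    have := Nat.notMem_of_lt_sInf hi
    simp only [Set.mem_ofPred_eq, Classical.not_imp, not_le] at this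
    exact this.2
  have hYt : Tendsto Y atTop atTop := by
    refine tendsto_atTop.2 fun b => ?_
    filter_upwards [eventually_gt_atTop (p b)⁻¹] with x hx
    have hx0 : 0 < x := (inv_pos.2 (hp0 b)).trans hx
    by_contra hlt
    have h1 := (hp (not_le.1 hlt).le).trans (hY1 x hx0)
    have h2 := inv_lt_of_inv_lt₀ (hp0 b) hx
    linarith
  have hinv : Tendsto (fun y => (p y)⁻¹) atTop atTop := by
    refine Tendsto.inv_tendsto_nhdsGT_zero ?_
    exact tendsto_nhdsWithin_iff.2 ⟨hplim, Eventually.of_forall hp0⟩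
  have hA : Tendsto (fun y => Φ ((p y)⁻¹) * ∑' i, q (y + i)) atTop (𝓝 1) := by
    have hne : ∀ᶠ y in atTop, Φ ((p y)⁻¹) ≠ 0 :=
      (hinv.eventually hΦ.eventually_pos).mono fun y hy => hy.ne'
    have h1 := ((isEquivalent_iff_tendsto_one hne).1 htail).inv₀ one_ne_zero
    rw [inv_one] at h1
    refine h1.congr fun y => ?_
    simp only [Pi.div_apply]
    rw [inv_div, div_inv_eq_mul]
  have hB : Tendsto (fun y => Φ ((p (y - 1))⁻¹) * ∑' i, q (y + i)) atTop (𝓝 1) := by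
    rw [← tendsto_add_atTop_iff_nat 1]
    have h1 := hA.mul (tendsto_tail_succ_div_tail hq0 hqs hclass)
    rw [one_mul] at h1
    refine h1.congr' ?_
    filter_upwards [hA.eventually (lt_mem_nhds zero_lt_one)] with y hy
    have : ∑' i, q (y + i) ≠ 0 := fun h => by simp [h] at hy
    simp only [Nat.add_sub_cancel]
    field_simp
  refine tendsto_one_of_eventually_le_mul (hA.comp hYt) (hB.comp hYt) fun ε hε => ?_
  obtain ⟨X, hX⟩ := hΦ.almost_mono ε hε
  filter_upwards [eventually_gt_atTop 0, eventually_ge_atTop X, hYt.eventually_ge_atTop 1,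
    ((tendsto_sub_atTop_nat 1).comp hYt).eventually (hinv.eventually_ge_atTop X)] with x h0 h1 h2 h3
  have hT : 0 ≤ ∑' i, q (Y x + i) := tsum_nonneg fun i => hq0 _
  rw [unpopularMass_eq_tail hq0 hqs hp (hY1 x h0) (hY2 x h0)]
  simp only [Function.comp] at h3 ⊢
  have h4 : (p (Y x - 1))⁻¹ ≤ x := (inv_lt_of_inv_lt₀ h0 (hY2 x h0 _ (by omega))).le
  have h5 : x ≤ (p (Y x))⁻¹ := (le_inv_comm₀ h0 (hp0 _)).2 (hY1 x h0)
  rw [← mul_assoc, ← mul_assoc]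
  exact ⟨mul_le_mul_of_nonneg_right (hX _ _ h3 h4) hT,
    mul_le_mul_of_nonneg_right (hX _ _ h1 h5) hT⟩

theorem hasSum_laplace_unpopularMass (hq0 : ∀ n, 0 ≤ q n) (hqs : Summable q)
    (hp0 : ∀ n, 0 < p n) {τ : ℝ} (hτ : 0 < τ) :
    HasSum (fun i => q i * Real.exp (-(τ * p i)))
      (∫ v in Set.Ioi (0 : ℝ), Real.exp (-v) * unpopularMass q p (v / τ)) := by
  set F : ℕ → ℝ → ℝ := fun i v => q i * (Set.Ici (τ * p i)).indicator (fun v => Real.exp (-v)) v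
    with hF
  have hsub : ∀ i, Set.Ioi (0 : ℝ) ∩ Set.Ici (τ * p i) = Set.Ici (τ * p i) := fun i =>
    Set.inter_eq_right.2 fun v (hv : τ * p i ≤ v) => (mul_pos hτ (hp0 i)).trans_le hv
  have hint : ∀ i, Integrable (F i) (volume.restrict (Set.Ioi (0 : ℝ))) := fun i => by
    refine Integrable.const_mul ?_ _
    have h1 : IntegrableOn (fun v : ℝ => Real.exp (-v)) (Set.Ioi 0) := integrableOn_exp_neg_Ioi 0
    exact h1.integrable.indicator measurableSet_Ici
  have hval : ∀ i, ∫ v in Set.Ioi (0 : ℝ), F i v = q i * Real.exp (-(τ * p i)) := fun i => by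
    rw [hF, integral_const_mul, setIntegral_indicator measurableSet_Ici, hsub i,
      integral_Ici_eq_integral_Ioi, integral_exp_neg_Ioi]
  have hnn : ∀ i v, 0 ≤ F i v := fun i v =>
    mul_nonneg (hq0 i) (Set.indicator_nonneg (fun _ _ => (Real.exp_pos _).le) _)
  have hnorm : Summable fun i => ∫ v in Set.Ioi (0 : ℝ), ‖F i v‖ := by
    simp_rw [fun i v => Real.norm_of_nonneg (hnn i v), hval]
    refine Summable.of_nonneg_of_le (fun i => mul_nonneg (hq0 i) (Real.exp_pos _).le)
      (fun i => ?_) hqs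
    refine mul_le_of_le_one_right (hq0 i) (Real.exp_le_one_iff.2 ?_)
    have := mul_pos hτ (hp0 i)
    linarith
  have key := hasSum_integral_of_summable_integral_norm hint hnorm
  simp_rw [hval] at key
  suffices h : ∀ v, Real.exp (-v) * unpopularMass q p (v / τ) = ∑' i, F i v by
    simpa only [h] using key
  intro v
  simp only [unpopularMass, ← tsum_mul_left]
  refine tsum_congr fun i => ?_
  simp only [hF, Set.indicator_apply, Set.mem_Ici, le_div_iff₀ hτ, mul_comm τ]
  split_ifs <;> ring

/-- The Abelian theorem behind the miss probability: the Laplace transform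
`∑ q_i exp (-τ p_i)` is asymptotic to `Γ(β + 1) / Φ(τ)`. -/
theorem tendsto_mul_tsum_exp {Φ : ℝ → ℝ} {β : ℝ} (hβ : 0 ≤ β) (hΦ : RegularGrowth Φ β)
    (hq0 : ∀ n, 0 ≤ q n) (hqs : Summable q)
    (hclass : Tendsto (fun n => q n / q (n + 1)) atTop (𝓝 1))
    (hp : Antitone p) (hp0 : ∀ n, 0 < p n) (hplim : Tendsto p atTop (𝓝 0))
    (htail : (fun y : ℕ => (∑' i, q (y + i))⁻¹) ~[atTop] fun y : ℕ => Φ ((p y)⁻¹)) :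
    Tendsto (fun τ => Φ τ * ∑' i, q i * Real.exp (-(τ * p i))) atTop
      (𝓝 (Real.Gamma (β + 1))) := by
  set G := unpopularMass q p with hG
  have hG1 : Tendsto (fun x => Φ x * G x⁻¹) atTop (𝓝 1) :=
    tendsto_mul_unpopularMass hΦ hq0 hqs hclass hp hp0 hplim htail
  have hGmono : Monotone G := monotone_unpopularMass hq0 hqs
  have hG0 : ∀ u, 0 ≤ G u := unpopularMass_nonneg hq0
  set Q := ∑' i, q i
  have hGQ : ∀ u, G u ≤ Q := unpopularMass_le hq0 hqs
  have hQ0 : 0 ≤ Q := tsum_nonneg hq0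
  obtain ⟨C, X₁, hC, hX₁, hpot⟩ := hΦ.potter
  obtain ⟨X₂, hX₂⟩ := eventually_atTop.1
    (hG1.eventually (gt_mem_nhds (show (1 : ℝ) < 2 by norm_num)))
  set X := max X₁ X₂ with hX
  have hXX₁ : X₁ ≤ X := le_max_left _ _
  have hXX₂ : X₂ ≤ X := le_max_right _ _
  have hX1 : 1 ≤ X := hX₁.trans hXX₁
  have hΦX : 0 < Φ X := (hpot X X hXX₁ le_rfl).1
  set D := 2 + 2 * C + C * Φ X * Q with hD
  have hbound : ∀ τ, X ≤ τ → ∀ v, 0 < v → Φ τ * G (v / τ) ≤ D * (1 + v ^ (β + 1)) := by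
    intro τ hτ v hv
    have hτ0 : 0 < τ := by linarith
    have hΦτ : 0 < Φ τ := (hpot τ τ (hXX₁.trans hτ) le_rfl).1
    have hvb : 0 < v ^ (β + 1) := Real.rpow_pos_of_pos hv _
    have hnn : 0 ≤ C * Φ X * Q := by positivity
    rcases le_total v 1 with h1 | h1
    · have h2 : G (v / τ) ≤ G τ⁻¹ := hGmono (by
        rw [div_eq_mul_inv]; exact mul_le_of_le_one_left (inv_pos.2 hτ0).le h1)
      calc Φ τ * G (v / τ) ≤ Φ τ * G τ⁻¹ := by gcongr
        _ ≤ 2 := (hX₂ τ (hXX₂.trans hτ)).le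
        _ ≤ D * 1 := by rw [hD]; linarith
        _ ≤ _ := by
          refine mul_le_mul_of_nonneg_left (by linarith) ?_
          rw [hD]; linarith
    · have hfin : ∀ E, 0 ≤ E → E ≤ D → E * v ^ (β + 1) ≤ D * (1 + v ^ (β + 1)) := by
        intro E hE hED
        have := mul_le_mul_of_nonneg_right hED hvb.le
        linarith
      rcases le_total X (τ / v) with h2 | h2
      · have h3 := (hpot (τ / v) τ (hXX₁.trans h2) (div_le_self hτ0.le h1)).2
        rw [div_div_cancel₀ hτ0.ne'] at h3
        have h4 := (hX₂ (τ / v) (hXX₂.trans h2)).le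
        rw [inv_div] at h4
        calc Φ τ * G (v / τ) ≤ (C * v ^ (β + 1) * Φ (τ / v)) * G (v / τ) :=
              mul_le_mul_of_nonneg_right h3 (hG0 _)
          _ = C * v ^ (β + 1) * (Φ (τ / v) * G (v / τ)) := by ring
          _ ≤ C * v ^ (β + 1) * 2 := by gcongr
          _ = (2 * C) * v ^ (β + 1) := by ring
          _ ≤ _ := hfin _ (by positivity) (by rw [hD]; linarith)
      · have h3 := (hpot X τ hXX₁ hτ).2
        have h4 : τ / X ≤ v := by
          rw [div_le_iff₀ hv] at h2
          rw [div_le_iff₀ (by linarith)]; linarith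
        calc Φ τ * G (v / τ) ≤ (C * v ^ (β + 1) * Φ X) * Q := by
              refine mul_le_mul (h3.trans ?_) (hGQ _) (hG0 _) (by positivity)
              gcongr
          _ = (C * Φ X * Q) * v ^ (β + 1) := by ring
          _ ≤ _ := hfin _ hnn (by rw [hD]; linarith)
  have hlim : ∀ v, 0 < v → Tendsto (fun τ => Φ τ * G (v / τ)) atTop (𝓝 (v ^ β)) := by
    intro v hv
    have hτv : Tendsto (fun τ : ℝ => v⁻¹ * τ) atTop atTop :=
      tendsto_id.const_mul_atTop (inv_pos.2 hv)
    have h1 := (hΦ.tendsto v⁻¹ (inv_pos.2 hv)).inv₀ (Real.rpow_pos_of_pos (inv_pos.2 hv) _).ne'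
    have h2 := (hG1.comp hτv).mul h1
    rw [one_mul, Real.inv_rpow hv.le, inv_inv] at h2
    refine h2.congr' ?_
    filter_upwards [hτv.eventually hΦ.eventually_pos, hΦ.eventually_pos] with τ h3 h4
    simp only [Function.comp]
    rw [mul_inv, inv_inv, inv_div, ← div_eq_mul_inv v τ]
    have h5 := h3.ne'
    generalize Φ (v⁻¹ * τ) = a at h5 ⊢
    field_simp
  have hint : ∀ s : ℝ, 0 ≤ s →
      IntegrableOn (fun v : ℝ => Real.exp (-v) * v ^ s) (Set.Ioi 0) := fun s hs => by
    have := Real.GammaIntegral_convergent (s := s + 1) (by linarith)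
    simpa using this
  have hdom := tendsto_integral_filter_of_dominated_convergence
    (μ := volume.restrict (Set.Ioi (0 : ℝ))) (l := atTop)
    (F := fun (τ : ℝ) v => Real.exp (-v) * (Φ τ * G (v / τ)))
    (f := fun v => Real.exp (-v) * v ^ β)
    (fun v => D * (Real.exp (-v) * v ^ (0 : ℝ) + Real.exp (-v) * v ^ (β + 1))) ?_ ?_ ?_ ?_
  · rw [Real.Gamma_eq_integral (by linarith)]
    simp only [add_sub_cancel_right]
    refine hdom.congr' ?_
    filter_upwards [eventually_gt_atTop 0] with τ hτ
    rw [(hasSum_laplace_unpopularMass hq0 hqs hp0 hτ).tsum_eq, ← integral_const_mul]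
    exact integral_congr_ae (Eventually.of_forall fun v => by simp only [hG]; ring)
  · filter_upwards with τ
    refine Measurable.aestronglyMeasurable ?_
    have := hGmono.measurable
    fun_prop
  · filter_upwards [eventually_ge_atTop X] with τ hτ
    filter_upwards [ae_restrict_mem measurableSet_Ioi] with v hv
    have hτ1 : X₁ ≤ τ := hXX₁.trans hτ
    have hΦτ : 0 < Φ τ := (hpot τ τ hτ1 le_rfl).1
    rw [Real.norm_of_nonneg (mul_nonneg (Real.exp_pos _).le (mul_nonneg hΦτ.le (hG0 _))),
      Real.rpow_zero, ← mul_add, mul_left_comm D]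
    exact mul_le_mul_of_nonneg_left (hbound τ hτ v hv) (Real.exp_pos _).le
  · exact ((hint 0 le_rfl).add (hint (β + 1) (by linarith))).const_mul D
  · filter_upwards [ae_restrict_mem measurableSet_Ioi] with v hv
    exact (hlim v hv).const_mul _

end UnpopularMass

/-! ### Void probabilities of a marked Poisson process -/

/-- Prepend a term to a sequence. -/
def consSeq {α : Type*} (z : α × (ℕ → α)) : ℕ → α := fun n => Nat.casesOn n z.1 z.2

@[simp] theorem consSeq_zero {α : Type*} (z : α × (ℕ → α)) : consSeq z 0 = z.1 := rfl

@[simp] theorem consSeq_succ {α : Type*} (z : α × (ℕ → α)) (n : ℕ) :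
    consSeq z (n + 1) = z.2 n := rfl

theorem measurable_consSeq {α : Type*} [MeasurableSpace α] :
    Measurable (consSeq : α × (ℕ → α) → ℕ → α) := by
  refine measurable_pi_iff.2 fun n => ?_
  cases n with
  | zero => exact measurable_fst
  | succ n => exact (measurable_pi_apply n).comp measurable_snd

/-- An i.i.d. sequence is an independent first term followed by an i.i.d. sequence. -/
theorem map_consSeq_prod_infinitePi {α : Type*} [MeasurableSpace α] (μ : Measure α)
    [IsProbabilityMeasure μ] :
    (μ.prod (Measure.infinitePi fun _ : ℕ => μ)).map consSeq
      = Measure.infinitePi fun _ : ℕ => μ := by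
  classical
  refine Measure.eq_infinitePi _ fun s t ht => ?_
  obtain ⟨N, hN⟩ : ∃ N, s ⊆ Finset.range (N + 1) :=
    ⟨s.sup id, fun i hi => Finset.mem_range.2 (Nat.lt_succ_of_le (Finset.le_sup (f := id) hi))⟩
  set t' : ℕ → Set α := fun i => if i ∈ s then t i else Set.univ with ht'
  have ht'm : ∀ i, MeasurableSet (t' i) := fun i => by
    simp only [ht']; split_ifs
    exacts [ht i, .univ]
  have hbox : consSeq ⁻¹' (Set.pi s t) = t' 0 ×ˢ Set.pi (Finset.range N) fun i => t' (i + 1) := by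
    ext z
    simp only [Set.mem_preimage, Set.mem_pi, Set.mem_prod, Finset.mem_coe, ht']
    constructor
    · refine fun h => ⟨?_, fun i _ => ?_⟩
      · split_ifs with h0
        exacts [h 0 h0, trivial]
      · split_ifs with h0
        exacts [h (i + 1) h0, trivial]
    · rintro ⟨h0, h1⟩ i hi
      cases i with
      | zero => simpa [hi] using h0
      | succ i =>
        have := h1 i (by have := Finset.mem_range.1 (hN hi); simp; omega)
        simpa [hi] using this
  rw [Measure.map_apply measurable_consSeq
    (MeasurableSet.pi s.countable_toSet fun i _ => ht i), hbox, Measure.prod_prod,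
    Measure.infinitePi_pi _ fun i _ => ht'm (i + 1), mul_comm, ← Finset.prod_range_succ'
      (fun i => μ (t' i))]
  rw [← Finset.prod_subset hN]
  · exact Finset.prod_congr rfl fun i hi => by simp [ht', hi]
  · intro i _ hi
    simp [ht', hi]

/-- The event that no point with mark in `B` has age less than `t`; a sequence of gaps and marks
describes the past of a marked point process. -/
def noMarkBefore (B : Set ℕ) (t : ℝ) : Set (ℕ → ℝ × ℕ) :=
  {w | ∀ n, (w n).2 ∈ B → t ≤ ∑ i ∈ Finset.range (n + 1), (w i).1}

theorem measurableSet_noMarkBefore (B : Set ℕ) (t : ℝ) : MeasurableSet (noMarkBefore B t) := by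
  rw [noMarkBefore, Set.ofPred_forall]
  refine MeasurableSet.iInter fun n => ?_
  have h1 : MeasurableSet {w : ℕ → ℝ × ℕ | (w n).2 ∈ B} :=
    (measurable_snd.comp (measurable_pi_apply n)) (MeasurableSet.of_discrete (s := B))
  have h2 : MeasurableSet {w : ℕ → ℝ × ℕ | t ≤ ∑ i ∈ Finset.range (n + 1), (w i).1} :=
    measurableSet_le measurable_const
      (Finset.measurable_sum _ fun i _ => measurable_fst.comp (measurable_pi_apply i))
  exact h1.imp h2

theorem consSeq_mem_noMarkBefore {B : Set ℕ} {t : ℝ} {z : (ℝ × ℕ) × (ℕ → ℝ × ℕ)} :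
    consSeq z ∈ noMarkBefore B t ↔
      (z.1.2 ∈ B → t ≤ z.1.1) ∧ z.2 ∈ noMarkBefore B (t - z.1.1) := by
  simp only [noMarkBefore, Set.mem_ofPred_eq]
  constructor
  · refine fun h => ⟨fun hz => by simpa using h 0 hz, fun n hn => ?_⟩
    have := h (n + 1) hn
    rw [Finset.sum_range_succ'] at this
    simp only [consSeq_succ, consSeq_zero] at this
    linarith
  · rintro ⟨h0, h1⟩ n hn
    cases n with
    | zero => simpa using h0 hn
    | succ n =>
      have := h1 n hn
      rw [Finset.sum_range_succ']
      simp only [consSeq_succ, consSeq_zero]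
      linarith

/-- A bounded solution of the renewal equation of a thinned Poisson process is an exponential. -/
theorem eq_exp_of_renewal {u : ℝ → ℝ} (hu : Antitone u) {r c : ℝ}
    (h : ∀ t, 0 ≤ t →
      u t = Real.exp (-(r * t)) + ∫ s in (0 : ℝ)..t, c * Real.exp (-(r * s)) * u (t - s))
    {t : ℝ} (ht : 0 ≤ t) : u t = Real.exp (-((r - c) * t)) := by
  set g : ℝ → ℝ := fun s => Real.exp (r * s) * u s with hg
  have hgi : ∀ a b, IntervalIntegrable g volume a b := fun a b =>
    (hu.intervalIntegrable).continuousOn_mul (by fun_prop)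
  set H : ℝ → ℝ := fun t => 1 + c * ∫ s in (0 : ℝ)..t, g s with hH
  have hHc : Continuous H := by
    have := intervalIntegral.continuous_primitive hgi 0
    fun_prop
  have hHg : ∀ t, 0 ≤ t → H t = g t := by
    intro t ht
    have h1 : ∫ s in (0 : ℝ)..t, c * Real.exp (-(r * s)) * u (t - s)
        = ∫ s in (0 : ℝ)..t, c * Real.exp (-(r * (t - s))) * u s := by
      have := intervalIntegral.integral_comp_sub_left (a := 0) (b := t)
        (fun s => c * Real.exp (-(r * (t - s))) * u s) t
      simpa using this
    have h2 : ∫ s in (0 : ℝ)..t, c * Real.exp (-(r * (t - s))) * u s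
        = Real.exp (-(r * t)) * (c * ∫ s in (0 : ℝ)..t, g s) := by
      rw [← intervalIntegral.integral_const_mul, ← intervalIntegral.integral_const_mul]
      refine intervalIntegral.integral_congr fun s _ => ?_
      simp only [hg]
      rw [show -(r * (t - s)) = -(r * t) + r * s by ring, Real.exp_add]
      ring
    have h3 := h t ht
    rw [h1, h2] at h3
    simp only [hH]
    change _ = Real.exp (r * t) * u t
    rw [h3, ← mul_one_add, ← mul_assoc, ← Real.exp_add]
    simp
  set J : ℝ → ℝ := fun t => 1 + c * ∫ s in (0 : ℝ)..t, H s with hJ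
  have hJH : ∀ t, 0 ≤ t → J t = H t := by
    intro t ht
    simp only [hJ]
    rw [intervalIntegral.integral_congr (g := g)]
    intro s hs
    rw [Set.uIcc_of_le ht] at hs
    exact hHg s hs.1
  have hJd : ∀ t, HasDerivAt J (c * H t) t := fun t =>
    ((intervalIntegral.integral_hasDerivAt_right (hHc.intervalIntegrable 0 t)
      (hHc.stronglyMeasurableAtFilter _ _) hHc.continuousAt).const_mul c).const_add 1
  have hKd : ∀ t, HasDerivAt (fun t => Real.exp (-(c * t)) * J t)
      (Real.exp (-(c * t)) * (-c) * J t + Real.exp (-(c * t)) * (c * H t)) t := by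
    intro t
    have h1 : HasDerivAt (fun t : ℝ => -(c * t)) (-c) t := by
      have := ((hasDerivAt_id t).const_mul (-c))
      simp only [id, mul_one, neg_mul] at this
      exact this
    exact h1.exp.mul (hJd t)
  have hconst := constant_of_has_deriv_right_zero (f := fun t => Real.exp (-(c * t)) * J t)
    (a := 0) (b := t) (fun s _ => (hKd s).continuousAt.continuousWithinAt) (fun s hs => by
      have := (hKd s).hasDerivWithinAt (s := Set.Ici s)
      rw [← hJH s hs.1] at this
      convert this using 1
      ring) t ⟨ht, le_rfl⟩
  have hJ0 : J 0 = 1 := by simp [hJ]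
  simp only [hJ0, mul_zero, neg_zero, Real.exp_zero, mul_one] at hconst
  rw [hJH t ht, hHg t ht] at hconst
  simp only [hg] at hconst
  have h5 : Real.exp (-(c * t)) * (Real.exp (r * t) * u t) = Real.exp ((r - c) * t) * u t := by
    rw [← mul_assoc, ← Real.exp_add]; ring_nf
  rw [h5] at hconst
  rw [Real.exp_neg]
  exact eq_inv_of_mul_eq_one_right hconst

theorem ae_nonneg_expMeasure (r : ℝ) : ∀ᵐ s ∂(expMeasure r), 0 ≤ s := by
  have h : expMeasure r {s | ¬ 0 ≤ s} = 0 := by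
    have hm : MeasurableSet {s : ℝ | ¬ 0 ≤ s} := measurableSet_Ici.compl
    rw [expMeasure, gammaMeasure, withDensity_apply _ hm]
    refine setLIntegral_eq_zero hm fun s hs => ?_
    exact gammaPDF_of_neg (not_le.1 hs)
  exact h

theorem integral_expMeasure {r : ℝ} (hr : 0 < r) (F : ℝ → ℝ) :
    ∫ s, F s ∂(expMeasure r) = ∫ s in Set.Ioi (0 : ℝ), r * Real.exp (-(r * s)) * F s := by
  have hm : Measurable (gammaPDF 1 r) := (measurable_gammaPDFReal 1 r).ennreal_ofReal
  rw [expMeasure, gammaMeasure, integral_withDensity_eq_integral_toReal_smul hm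
    (Eventually.of_forall fun _ => ENNReal.ofReal_lt_top), ← integral_Ici_eq_integral_Ioi,
    ← integral_indicator measurableSet_Ici]
  refine integral_congr_ae (Eventually.of_forall fun s => ?_)
  have h1 : gammaPDF 1 r s = ENNReal.ofReal (if 0 ≤ s then r * Real.exp (-(r * s)) else 0) :=
    exponentialPDF_eq r s
  simp only [h1, Set.indicator_apply, Set.mem_Ici, smul_eq_mul]
  split_ifs with h
  · rw [ENNReal.toReal_ofReal (by positivity)]
  · simp

section

variable (r : ℝ) (p : PMF ℕ)

/-- The law of the gaps and the marks of the past of a Poisson process of rate `r` with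
independent marks of law `p`. -/
def markedPoisson : Measure (ℕ → ℝ × ℕ) :=
  Measure.infinitePi fun _ : ℕ => (expMeasure r).prod p.toMeasure

variable {r}

theorem isProbabilityMeasure_markedPoisson (hr : 0 < r) :
    IsProbabilityMeasure (markedPoisson r p) := by
  have := isProbabilityMeasure_expMeasure hr
  rw [markedPoisson]
  infer_instance

theorem markedPoisson_noMarkBefore_of_nonpos (hr : 0 < r) (B : Set ℕ) {t : ℝ} (ht : t ≤ 0) :
    (markedPoisson r p).real (noMarkBefore B t) = 1 := by
  have := isProbabilityMeasure_expMeasure hr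
  have := isProbabilityMeasure_markedPoisson p hr
  have h1 : ∀ᵐ w ∂(markedPoisson r p), ∀ n, 0 ≤ (w n).1 := by
    refine ae_all_iff.2 fun n => ?_
    have h2 : MeasurePreserving (fun w : ℕ → ℝ × ℕ => w n) (markedPoisson r p)
        ((expMeasure r).prod p.toMeasure) := measurePreserving_eval_infinitePi _ n
    have h3 : ∀ᵐ z ∂((expMeasure r).prod p.toMeasure), 0 ≤ z.1 :=
      Measure.quasiMeasurePreserving_fst.ae (ae_nonneg_expMeasure r)
    exact h2.quasiMeasurePreserving.ae h3
  have h2 : markedPoisson r p (noMarkBefore B t) = 1 := by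
    rw [prob_compl_eq_zero_iff (measurableSet_noMarkBefore B t) |>.symm]
    refine measure_mono_null ?_ h1
    intro w hw hn
    exact hw fun n _ => ht.trans (Finset.sum_nonneg fun i _ => hn i)
  rw [measureReal_def, h2, ENNReal.toReal_one]

/-- The first-step decomposition with respect to the last point before time `0`. -/
theorem markedPoisson_noMarkBefore_renewal (hr : 0 < r) (B : Set ℕ) {t : ℝ} (ht : 0 ≤ t) :
    (markedPoisson r p).real (noMarkBefore B t) = Real.exp (-(r * t)) +
      ∫ s in (0 : ℝ)..t, r * (1 - (p.toMeasure B).toReal) * Real.exp (-(r * s)) *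
        (markedPoisson r p).real (noMarkBefore B (t - s)) := by
  have := isProbabilityMeasure_expMeasure hr
  have := isProbabilityMeasure_markedPoisson p hr
  set u : ℝ → ℝ := fun t => (markedPoisson r p).real (noMarkBefore B t) with hu
  have huanti : Antitone u := fun a b hab =>
    measureReal_mono (fun w hw n hn => hab.trans (hw n hn))
  have hum : Measurable u := huanti.measurable
  have hu0 : ∀ t, 0 ≤ u t := fun t => measureReal_nonneg
  have hu1 : ∀ t, u t ≤ 1 := fun t => measureReal_le_one
  set b := (p.toMeasure B).toReal with hb
  have hb0 : 0 ≤ b := ENNReal.toReal_nonneg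
  have hb1 : b ≤ 1 := measureReal_le_one
  have hstep : u t = ∫ s, (if t ≤ s then 1 else (1 - b)) * u (t - s) ∂(expMeasure r) := by
    classical
    set μ := (expMeasure r).prod p.toMeasure with hμ
    have hV : ∀ t, MeasurableSet (noMarkBefore B t) := measurableSet_noMarkBefore B
    have hFm : Measurable fun z : ℝ × ℕ =>
        if z.2 ∈ B → t ≤ z.1 then ENNReal.ofReal (u (t - z.1)) else 0 := by
      refine Measurable.ite ?_ (by fun_prop) measurable_const
      exact (measurable_snd (MeasurableSet.of_discrete (s := B))).imp
        (measurableSet_le measurable_const measurable_fst)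
    have h1 : markedPoisson r p (noMarkBefore B t)
        = ∫⁻ z, (if z.2 ∈ B → t ≤ z.1 then ENNReal.ofReal (u (t - z.1)) else 0) ∂μ := by
      nth_rewrite 1 [markedPoisson]
      rw [← map_consSeq_prod_infinitePi, Measure.map_apply measurable_consSeq (hV t),
        Measure.prod_apply (measurable_consSeq (hV t))]
      refine lintegral_congr fun z => ?_
      have h2 : Prod.mk z ⁻¹' (consSeq ⁻¹' noMarkBefore B t)
          = {w | (z.2 ∈ B → t ≤ z.1) ∧ w ∈ noMarkBefore B (t - z.1)} := by
        ext w
        exact consSeq_mem_noMarkBefore (z := (z, w))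
      rw [h2]
      split_ifs with h
      · rw [hu, ofReal_measureReal]
        congr 1
        ext w
        exact and_iff_right h
      · simp [h]
    have h3 : ∀ s, ∫⁻ d, (if d ∈ B → t ≤ s then ENNReal.ofReal (u (t - s)) else 0) ∂p.toMeasure
        = ENNReal.ofReal ((if t ≤ s then 1 else (1 - b)) * u (t - s)) := by
      intro s
      by_cases h : t ≤ s
      · simp [h]
      · have h4 : ∀ d, (if d ∈ B → t ≤ s then ENNReal.ofReal (u (t - s)) else 0)
            = Bᶜ.indicator (fun _ => ENNReal.ofReal (u (t - s))) d := fun d => by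
          by_cases hd : d ∈ B <;> simp [h, hd]
        simp_rw [h4]
        rw [lintegral_indicator_const MeasurableSet.of_discrete, if_neg h, mul_comm,
          ENNReal.ofReal_mul' (hu0 _), hb, ← measureReal_def, ← probReal_compl_eq_one_sub
          MeasurableSet.of_discrete, ofReal_measureReal, ofReal_measureReal]
    have hif : ∀ s, 0 ≤ (if t ≤ s then 1 else (1 - b)) * u (t - s) := fun s => by
      refine mul_nonneg ?_ (hu0 _)
      split_ifs <;> linarith
    rw [hμ, lintegral_prod _ hFm.aemeasurable] at h1
    simp_rw [h3] at h1
    rw [hu]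
    simp only
    rw [measureReal_def, h1, ← integral_eq_lintegral_of_nonneg_ae (Eventually.of_forall hif)]
    refine Measurable.aestronglyMeasurable ?_
    refine Measurable.mul (Measurable.ite measurableSet_Ici measurable_const measurable_const) ?_
    fun_prop
  rw [integral_expMeasure hr] at hstep
  have hexp : IntegrableOn (fun s => r * Real.exp (-(r * s))) (Set.Ioi 0) := by
    simp_rw [← neg_mul]
    exact (exp_neg_integrableOn_Ioi 0 hr).const_mul r
  have hint : IntegrableOn (fun s => r * Real.exp (-(r * s)) *
      ((if t ≤ s then 1 else (1 - b)) * u (t - s))) (Set.Ioi 0) := by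
    refine hexp.mono' ?_ (Eventually.of_forall fun s => ?_)
    · refine Measurable.aestronglyMeasurable ?_
      refine Measurable.mul (by fun_prop) (Measurable.mul
        (Measurable.ite measurableSet_Ici measurable_const measurable_const) ?_)
      fun_prop
    · have h5 : 0 ≤ (if t ≤ s then 1 else (1 - b)) ∧ (if t ≤ s then 1 else (1 - b)) ≤ 1 := by
        split_ifs <;> constructor <;> linarith
      have h6 : 0 ≤ r * Real.exp (-(r * s)) := by positivity
      rw [Real.norm_of_nonneg (mul_nonneg h6 (mul_nonneg h5.1 (hu0 _)))]
      exact mul_le_of_le_one_right h6 (mul_le_one₀ h5.2 (hu0 _) (hu1 _))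
  have hsplit : Set.Ioi (0 : ℝ) = Set.Ioc 0 t ∪ Set.Ioi t := (Set.Ioc_union_Ioi_eq_Ioi ht).symm
  change u t = _ + ∫ s in (0 : ℝ)..t, r * (1 - b) * Real.exp (-(r * s)) * u (t - s)
  rw [hstep, hsplit, setIntegral_union Set.Ioc_disjoint_Ioi_same measurableSet_Ioi
    (hint.mono_set (by rw [hsplit]; exact Set.subset_union_left))
    (hint.mono_set (by rw [hsplit]; exact Set.subset_union_right)), add_comm]
  congr 1
  · have h7 : ∀ s ∈ Set.Ioi t, r * Real.exp (-(r * s)) *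
        ((if t ≤ s then 1 else (1 - b)) * u (t - s)) = r * Real.exp (-r * s) := by
      intro s hs
      have hs' : t < s := hs
      rw [if_pos hs'.le, hu]
      simp only
      rw [markedPoisson_noMarkBefore_of_nonpos p hr B (by linarith)]
      ring_nf
    rw [setIntegral_congr_fun measurableSet_Ioi h7, integral_const_mul,
      integral_exp_mul_Ioi (by linarith)]
    field_simp
  · rw [intervalIntegral.integral_of_le ht, integral_Ioc_eq_integral_Ioo,
      integral_Ioc_eq_integral_Ioo]
    refine setIntegral_congr_fun measurableSet_Ioo fun s hs => ?_
    simp only [not_le.2 hs.2, if_false]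
    ring

/-- Thinning: the points with marks in `B` form a Poisson process of rate `r * p B`. -/
theorem markedPoisson_noMarkBefore (hr : 0 < r) (B : Set ℕ) {t : ℝ} (ht : 0 ≤ t) :
    (markedPoisson r p).real (noMarkBefore B t)
      = Real.exp (-(r * (p.toMeasure B).toReal * t)) := by
  have := isProbabilityMeasure_markedPoisson p hr
  have h := eq_exp_of_renewal (u := fun t => (markedPoisson r p).real (noMarkBefore B t))
    (fun a b hab => measureReal_mono (fun w hw n hn => hab.trans (hw n hn)))
    (fun t ht => markedPoisson_noMarkBefore_renewal p hr B ht) ht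
  rw [h]
  ring_nf

end

/-! ### The items requested within a given time -/

namespace CacheSystem

variable {M : ℕ} (S : CacheSystem M)

/-- The rate of the mixed flow. -/
def totalRate : ℝ := ∑ j, S.rate j

/-- The law of the requests before time `0`. -/
def past : Measure (Fin M → ℕ → ℝ × ℕ) := Measure.pi fun k => S.pastLaw k

instance (k : Fin M) : IsProbabilityMeasure (S.pastLaw k) :=
  isProbabilityMeasure_markedPoisson (S.pop k) (S.rate_pos k)

instance : IsProbabilityMeasure S.past := by
  rw [past]; infer_instance

theorem totalRate_pos (k : Fin M) : 0 < S.totalRate :=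
  Finset.sum_pos (fun j _ => S.rate_pos j) ⟨k, Finset.mem_univ k⟩

theorem flowProb_pos (k : Fin M) : 0 < S.flowProb k :=
  div_pos (S.rate_pos k) (S.totalRate_pos k)

theorem condProb_nonneg (k : Fin M) (d : ℕ) : 0 ≤ S.condProb k d := ENNReal.toReal_nonneg

theorem hasSum_condProb (k : Fin M) : HasSum (S.condProb k) 1 := by
  have h := (S.pop k).hasSum_coe_one
  have h2 : Summable (S.condProb k) := ENNReal.summable_toReal (by rw [h.tsum_eq]; simp)
  have h3 : ∑' d, S.condProb k d = 1 := by
    rw [show S.condProb k = fun d => (S.pop k d).toReal from rfl,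
      ← ENNReal.tsum_toReal_eq fun d => (S.pop k).apply_ne_top d, h.tsum_eq, ENNReal.toReal_one]
  exact h3 ▸ h2.hasSum

theorem mixedProb_nonneg (d : ℕ) : 0 ≤ S.mixedProb d :=
  Finset.sum_nonneg fun j _ => mul_nonneg (S.flowProb_pos j).le (S.condProb_nonneg j d)

theorem sum_flowProb (k : Fin M) : ∑ j, S.flowProb j = 1 := by
  simp only [flowProb, ← Finset.sum_div]
  exact div_self (S.totalRate_pos k).ne'

theorem hasSum_mixedProb (k : Fin M) : HasSum S.mixedProb 1 := by
  have h := hasSum_sum (s := Finset.univ) fun j (_ : j ∈ Finset.univ) =>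
    (S.hasSum_condProb j).mul_left (S.flowProb j)
  simp only [mul_one, S.sum_flowProb k] at h
  exact h

theorem totalRate_mul_mixedProb (k : Fin M) (d : ℕ) :
    S.totalRate * S.mixedProb d = ∑ j, S.rate j * S.condProb j d := by
  rw [mixedProb, Finset.mul_sum]
  refine Finset.sum_congr rfl fun j _ => ?_
  have h := (S.totalRate_pos k).ne'
  rw [flowProb, ← totalRate]
  field_simp

/-- The event that item `d` has not been requested within the time `t` before time `0`. -/
def unseen (t : ℝ) (d : ℕ) : Set (Fin M → ℕ → ℝ × ℕ) :=
  {w | ∀ j, w j ∈ noMarkBefore {d} t}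

theorem measurableSet_unseen (t : ℝ) (d : ℕ) :
    MeasurableSet (unseen t d : Set (Fin M → ℕ → ℝ × ℕ)) := by
  rw [unseen, Set.ofPred_forall]
  exact MeasurableSet.iInter fun j =>
    (measurable_pi_apply j) (measurableSet_noMarkBefore {d} t)

theorem ofReal_le_lastAge_iff {t : ℝ} (ht : 0 < t) (ω : Config M) (d : ℕ) :
    ENNReal.ofReal t ≤ lastAge ω d ↔ ω.2 ∈ unseen t d := by
  simp only [lastAge, le_iInf_iff, unseen, noMarkBefore, Set.mem_ofPred_eq, Set.mem_singleton_iff,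
    age]
  refine forall_congr' fun j => forall_congr' fun n => imp_congr_right fun _ => ?_
  rw [ENNReal.ofReal_le_ofReal_iff']
  exact or_iff_left (not_le.2 ht)

/-- The superposition of the flows: the last requests of the items are jointly distributed as for a
single Poisson process with marks of law `mixedProb`. -/
theorem past_biInter_unseen (k : Fin M) {t : ℝ} (ht : 0 ≤ t) (s : Finset ℕ) :
    S.past.real (⋂ d ∈ s, unseen t d)
      = ∏ d ∈ s, Real.exp (-(S.totalRate * t * S.mixedProb d)) := by
  have h1 : (⋂ d ∈ s, unseen t d : Set (Fin M → ℕ → ℝ × ℕ))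
      = Set.pi Set.univ fun _ => noMarkBefore (↑s) t := by
    ext w
    simp only [Set.mem_iInter, unseen, noMarkBefore, Set.mem_ofPred_eq, Set.mem_singleton_iff,
      Set.mem_pi, Set.mem_univ, true_imp_iff, Finset.mem_coe]
    exact ⟨fun h j n hn => h _ hn j n rfl, fun h d hd j n hn => h j n (hn ▸ hd)⟩
  have h2 : ∀ j, ((S.pop j).toMeasure (↑s : Set ℕ)).toReal = ∑ d ∈ s, S.condProb j d := fun j => by
    rw [PMF.toMeasure_apply_finset, ENNReal.toReal_sum fun d _ => (S.pop j).apply_ne_top d]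
    rfl
  rw [h1, past, measureReal_def, Measure.pi_pi, ENNReal.toReal_prod]
  have h3 : ∀ j, ((S.pastLaw j) (noMarkBefore (↑s) t)).toReal
      = Real.exp (-(S.rate j * (∑ d ∈ s, S.condProb j d) * t)) := fun j => by
    rw [← h2 j]
    exact markedPoisson_noMarkBefore (S.pop j) (S.rate_pos j) _ ht
  simp_rw [h3]
  rw [← Real.exp_sum, ← Real.exp_sum]
  congr 1
  rw [Finset.sum_neg_distrib, Finset.sum_neg_distrib]
  congr 1
  have h4 : ∀ d, S.totalRate * t * S.mixedProb d = ∑ j, S.rate j * S.condProb j d * t := fun d => by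
    rw [mul_right_comm, S.totalRate_mul_mixedProb k, Finset.sum_mul]
  simp_rw [h4]
  rw [Finset.sum_comm]
  refine Finset.sum_congr rfl fun j _ => ?_
  rw [Finset.mul_sum, Finset.sum_mul]

theorem past_unseen (k : Fin M) {t : ℝ} (ht : 0 ≤ t) (d : ℕ) :
    S.past.real (unseen t d) = Real.exp (-(S.totalRate * t * S.mixedProb d)) := by
  simpa using S.past_biInter_unseen k ht {d}

theorem iIndepSet_unseen (k : Fin M) {t : ℝ} (ht : 0 ≤ t) :
    iIndepSet (fun d => unseen t d) S.past := by
  rw [iIndepSet_iff_meas_biInter fun d => measurableSet_unseen t d]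
  intro s
  rw [← ENNReal.toReal_eq_toReal_iff' (measure_ne_top _ _)
    (ENNReal.prod_ne_top fun d _ => measure_ne_top _ _), ENNReal.toReal_prod]
  have h := S.past_biInter_unseen k ht s
  rw [measureReal_def] at h
  rw [h]
  exact Finset.prod_congr rfl fun d _ => (S.past_unseen k ht d).symm

/-! ### Concentration of the total size of the requested items -/

/-- The size of item `d` if it has been requested within the time `t` before time `0`,
and `0` otherwise. -/
def itemSeen (t : ℝ) (d : ℕ) (w : Fin M → ℕ → ℝ × ℕ) : ℝ :=
  S.size d * (1 - (unseen t d).indicator (fun _ => 1) w)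

theorem measurable_itemSeen (t : ℝ) (d : ℕ) : Measurable (S.itemSeen t d) := by
  have : Measurable ((unseen t d : Set (Fin M → ℕ → ℝ × ℕ)).indicator fun _ => (1 : ℝ)) :=
    measurable_const.indicator (measurableSet_unseen t d)
  unfold itemSeen
  fun_prop

theorem itemSeen_nonneg (t : ℝ) (d : ℕ) (w : Fin M → ℕ → ℝ × ℕ) : 0 ≤ S.itemSeen t d w := by
  classical
  refine mul_nonneg (S.size_nonneg d) ?_
  rw [Set.indicator_apply]
  split_ifs <;> norm_num

theorem itemSeen_le (t : ℝ) (d : ℕ) (w : Fin M → ℕ → ℝ × ℕ) : S.itemSeen t d w ≤ S.size d := by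
  classical
  refine mul_le_of_le_one_right (S.size_nonneg d) ?_
  rw [Set.indicator_apply]
  split_ifs <;> norm_num

theorem iIndepFun_itemSeen (k : Fin M) {t : ℝ} (ht : 0 ≤ t) :
    iIndepFun (S.itemSeen t) S.past := by
  have h := (S.iIndepSet_unseen k ht).iIndepFun_indicator (β := ℝ) (m := inferInstance)
  exact h.comp (fun d x => S.size d * (1 - x)) fun d => by fun_prop

theorem mgf_itemSeen_le (k : Fin M) {t : ℝ} (ht : 0 ≤ t) {B θ : ℝ} (hB : ∀ d, S.size d ≤ B)
    (hθ : |θ| * B ≤ 1) (d : ℕ) :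
    mgf (S.itemSeen t d) S.past θ ≤ Real.exp ((θ + θ ^ 2 * B) *
      (S.size d * (1 - Real.exp (-(S.totalRate * t * S.mixedProb d))))) := by
  classical
  set U : Set (Fin M → ℕ → ℝ × ℕ) := unseen t d with hU
  set s := S.size d
  have hs0 : 0 ≤ s := S.size_nonneg d
  have hsB : s ≤ B := hB d
  set a := Real.exp (-(S.totalRate * t * S.mixedProb d)) with ha
  have ha1 : a ≤ 1 := by
    rw [ha, ← S.past_unseen k ht d]; exact measureReal_le_one
  have h1 : ∀ w, Real.exp (θ * S.itemSeen t d w)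
      = Real.exp (θ * s) + U.indicator (fun _ => 1 - Real.exp (θ * s)) w := fun w => by
    simp only [itemSeen, Set.indicator_apply]
    split_ifs <;> simp [s]
  have hUm : MeasurableSet U := measurableSet_unseen t d
  have h2 : mgf (S.itemSeen t d) S.past θ = Real.exp (θ * s) + a * (1 - Real.exp (θ * s)) := by
    rw [mgf]
    simp_rw [h1]
    rw [integral_add (integrable_const _) ((integrable_const _).indicator hUm), integral_const,
      integral_indicator_const _ hUm, hU, S.past_unseen k ht d]
    simp [ha]
  have h3 : |θ * s| ≤ 1 := by
    rw [abs_mul, abs_of_nonneg hs0]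
    exact (mul_le_mul_of_nonneg_left hsB (abs_nonneg θ)).trans hθ
  have h4 := (abs_le.1 (Real.abs_exp_sub_one_sub_id_le h3)).2
  have h5 : Real.exp (θ * s) - 1 ≤ (θ + θ ^ 2 * B) * s := by
    have : θ ^ 2 * (s * s) ≤ θ ^ 2 * (B * s) := by gcongr
    nlinarith
  calc mgf (S.itemSeen t d) S.past θ = (Real.exp (θ * s) - 1) * (1 - a) + 1 := by rw [h2]; ring
    _ ≤ (θ + θ ^ 2 * B) * s * (1 - a) + 1 := by gcongr
    _ ≤ Real.exp ((θ + θ ^ 2 * B) * s * (1 - a)) := Real.add_one_le_exp _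
    _ = _ := by ring_nf

theorem mgf_sum_itemSeen_le (k : Fin M) {t : ℝ} (ht : 0 ≤ t) {B θ : ℝ} (hB : ∀ d, S.size d ≤ B)
    (hθ : |θ| * B ≤ 1) (n : ℕ) :
    mgf (fun w => ∑ d ∈ Finset.range n, S.itemSeen t d w) S.past θ
      ≤ Real.exp ((θ + θ ^ 2 * B) * ∑ d ∈ Finset.range n,
        S.size d * (1 - Real.exp (-(S.totalRate * t * S.mixedProb d)))) := by
  have h1 := (S.iIndepFun_itemSeen k ht).mgf_sum (t := θ) (fun d => S.measurable_itemSeen t d)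
    (Finset.range n)
  have h2 : (∑ d ∈ Finset.range n, S.itemSeen t d)
      = fun w => ∑ d ∈ Finset.range n, S.itemSeen t d w := by
    ext w; simp
  rw [← h2, h1, Finset.mul_sum, Real.exp_sum]
  exact Finset.prod_le_prod (fun d _ => mgf_nonneg) fun d _ => S.mgf_itemSeen_le k ht hB hθ d

theorem integrable_exp_sum_itemSeen (t θ : ℝ) (n : ℕ) :
    Integrable (fun w => Real.exp (θ * ∑ d ∈ Finset.range n, S.itemSeen t d w)) S.past := by
  have hm : Measurable fun w => ∑ d ∈ Finset.range n, S.itemSeen t d w :=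
    Finset.measurable_sum _ fun d _ => S.measurable_itemSeen t d
  refine Integrable.of_bound (C := Real.exp (|θ| * ∑ d ∈ Finset.range n, S.size d))
    (Real.measurable_exp.comp (hm.const_mul θ)).aestronglyMeasurable
    (Eventually.of_forall fun w => ?_)
  rw [Real.norm_of_nonneg (Real.exp_pos _).le, Real.exp_le_exp]
  have h0 : 0 ≤ ∑ d ∈ Finset.range n, S.itemSeen t d w :=
    Finset.sum_nonneg fun d _ => S.itemSeen_nonneg t d w
  calc θ * ∑ d ∈ Finset.range n, S.itemSeen t d w
      ≤ |θ| * ∑ d ∈ Finset.range n, S.itemSeen t d w := by gcongr; exact le_abs_self θ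
    _ ≤ _ := by gcongr with d _; exact S.itemSeen_le t d w

/-- The total size of the items requested within the time `t` before time `0`. -/
def seenSize (t : ℝ) (w : Fin M → ℕ → ℝ × ℕ) : ℝ≥0∞ := ∑' d, ENNReal.ofReal (S.itemSeen t d w)

/-- The expected total size of the items requested within a time in which `τ` requests of the mixed
flow are expected. -/
def expectedSeen (τ : ℝ) : ℝ := ∑' d, S.size d * (1 - Real.exp (-(τ * S.mixedProb d)))

theorem measurable_seenSize (t : ℝ) : Measurable (S.seenSize t) :=
  Measurable.tsum fun d => (S.measurable_itemSeen t d).ennreal_ofReal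

theorem exists_size_le : ∃ B : ℝ, 1 ≤ B ∧ ∀ d, S.size d ≤ B := by
  obtain ⟨B, hB⟩ := S.size_bdd
  exact ⟨max 1 B, le_max_left _ _, fun d => (hB ⟨d, rfl⟩).trans (le_max_right _ _)⟩

theorem one_sub_exp_mixedProb_nonneg {τ : ℝ} (hτ : 0 ≤ τ) (d : ℕ) :
    0 ≤ S.size d * (1 - Real.exp (-(τ * S.mixedProb d))) := by
  refine mul_nonneg (S.size_nonneg d) (sub_nonneg.2 (Real.exp_le_one_iff.2 ?_))
  have := mul_nonneg hτ (S.mixedProb_nonneg d)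
  linarith

theorem summable_expectedSeen (k : Fin M) {τ : ℝ} (hτ : 0 ≤ τ) :
    Summable fun d => S.size d * (1 - Real.exp (-(τ * S.mixedProb d))) := by
  obtain ⟨B, hB1, hB⟩ := S.exists_size_le
  refine Summable.of_nonneg_of_le (S.one_sub_exp_mixedProb_nonneg hτ) (fun d => ?_)
    ((S.hasSum_mixedProb k).summable.mul_left (B * τ))
  have h1 := Real.add_one_le_exp (-(τ * S.mixedProb d))
  have h2 := mul_nonneg hτ (S.mixedProb_nonneg d)
  calc S.size d * (1 - Real.exp (-(τ * S.mixedProb d))) ≤ S.size d * (τ * S.mixedProb d) :=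
        mul_le_mul_of_nonneg_left (by linarith) (S.size_nonneg d)
    _ ≤ B * (τ * S.mixedProb d) := mul_le_mul_of_nonneg_right (hB d) h2
    _ = _ := by ring

/-- Chernoff bound for the upper tail. -/
theorem past_lt_seenSize_le (k : Fin M) {t : ℝ} (ht : 0 ≤ t) {B θ : ℝ}
    (hB : ∀ d, S.size d ≤ B) (hθ0 : 0 ≤ θ) (hθ : θ * B ≤ 1) {x : ℝ} (hx : 0 ≤ x) :
    S.past.real {w | ENNReal.ofReal x < S.seenSize t w}
      ≤ Real.exp (-(θ * x) + (θ + θ ^ 2 * B) * S.expectedSeen (S.totalRate * t)) := by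
  set A : ℕ → Set (Fin M → ℕ → ℝ × ℕ) := fun n =>
    {w | x ≤ ∑ d ∈ Finset.range n, S.itemSeen t d w} with hA
  have hB0 : 0 ≤ B := (S.size_nonneg 0).trans (hB 0)
  have hτ : 0 ≤ S.totalRate * t := mul_nonneg (S.totalRate_pos k).le ht
  have hbound : ∀ n, S.past.real (A n)
      ≤ Real.exp (-(θ * x) + (θ + θ ^ 2 * B) * S.expectedSeen (S.totalRate * t)) := fun n => by
    refine (measure_ge_le_exp_mul_mgf x hθ0 (S.integrable_exp_sum_itemSeen t θ n)).trans ?_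
    rw [Real.exp_add, neg_mul]
    refine mul_le_mul_of_nonneg_left ((S.mgf_sum_itemSeen_le k ht hB
      (by rwa [abs_of_nonneg hθ0]) n).trans (Real.exp_le_exp.2 ?_)) (Real.exp_pos _).le
    refine mul_le_mul_of_nonneg_left ?_ (by positivity)
    exact (S.summable_expectedSeen k hτ).sum_le_tsum _
      fun d _ => S.one_sub_exp_mixedProb_nonneg hτ d
  have hAmono : Monotone A := fun m n hmn w hw => le_trans (show x ≤ _ from hw)
    (Finset.sum_le_sum_of_subset_of_nonneg (Finset.range_mono hmn)
      fun d _ _ => S.itemSeen_nonneg t d w)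
  have hsub : {w | ENNReal.ofReal x < S.seenSize t w} ⊆ ⋃ n, A n := by
    intro w hw
    have h1 : Tendsto (fun n => ∑ d ∈ Finset.range n, ENNReal.ofReal (S.itemSeen t d w)) atTop
      (𝓝 (S.seenSize t w)) := ENNReal.tendsto_nat_tsum _
    obtain ⟨n, hn⟩ := (h1.eventually (lt_mem_nhds hw)).exists
    rw [← ENNReal.ofReal_sum_of_nonneg fun d _ => S.itemSeen_nonneg t d w] at hn
    exact Set.mem_iUnion.2 ⟨n, ((ENNReal.ofReal_lt_ofReal_iff_of_nonneg hx).1 hn).le⟩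
  refine (measureReal_mono hsub).trans ?_
  have h2 := tendsto_measure_iUnion_atTop (μ := S.past) hAmono
  have h3 := (ENNReal.tendsto_toReal (measure_ne_top S.past (⋃ n, A n))).comp h2
  exact le_of_tendsto' h3 hbound

/-- Chernoff bound for the lower tail. -/
theorem past_seenSize_le_le (k : Fin M) {t : ℝ} (ht : 0 ≤ t) {B θ : ℝ}
    (hB : ∀ d, S.size d ≤ B) (hθ0 : 0 ≤ θ) (hθ : θ * B ≤ 1) {x : ℝ} (hx : 0 ≤ x) :
    S.past.real {w | S.seenSize t w ≤ ENNReal.ofReal x}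
      ≤ Real.exp (θ * x + (-θ + θ ^ 2 * B) * S.expectedSeen (S.totalRate * t)) := by
  have hτ : 0 ≤ S.totalRate * t := mul_nonneg (S.totalRate_pos k).le ht
  have h1 : ∀ n, S.past.real {w | S.seenSize t w ≤ ENNReal.ofReal x}
      ≤ Real.exp (θ * x + (-θ + θ ^ 2 * B) * ∑ d ∈ Finset.range n,
        S.size d * (1 - Real.exp (-(S.totalRate * t * S.mixedProb d)))) := fun n => by
    have hsub : {w | S.seenSize t w ≤ ENNReal.ofReal x}
        ⊆ {w | ∑ d ∈ Finset.range n, S.itemSeen t d w ≤ x} := by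
      intro w hw
      have h2 : ∑ d ∈ Finset.range n, ENNReal.ofReal (S.itemSeen t d w) ≤ S.seenSize t w :=
        ENNReal.sum_le_tsum _
      rw [← ENNReal.ofReal_sum_of_nonneg fun d _ => S.itemSeen_nonneg t d w] at h2
      exact (ENNReal.ofReal_le_ofReal_iff hx).1 (h2.trans hw)
    refine (measureReal_mono hsub).trans ?_
    refine (measure_le_le_exp_mul_mgf x (neg_nonpos.2 hθ0)
      (S.integrable_exp_sum_itemSeen t (-θ) n)).trans ?_
    rw [Real.exp_add, neg_neg]
    refine mul_le_mul_of_nonneg_left ?_ (Real.exp_pos _).le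
    have := S.mgf_sum_itemSeen_le k ht hB (θ := -θ) (by rwa [abs_neg, abs_of_nonneg hθ0]) n
    rwa [neg_sq] at this
  have h2 := (S.summable_expectedSeen k hτ).hasSum.tendsto_sum_nat
  have h3 := (Real.continuous_exp.tendsto _).comp
    ((h2.const_mul (-θ + θ ^ 2 * B)).const_add (θ * x))
  exact ge_of_tendsto' h3 h1

/-! ### Bounds for the miss probability -/

/-- The law of the request process given that flow `k` issues the request at time `0`. -/
def flowLaw (k : Fin M) : Measure (Config M) :=
  ((Measure.dirac k).prod (S.pop k).toMeasure).prod S.past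

instance (k : Fin M) : IsProbabilityMeasure (S.flowLaw k) := by
  rw [flowLaw]; infer_instance

theorem restrict_currentLaw (k : Fin M) :
    S.currentLaw.restrict ({k} ×ˢ Set.univ)
      = ENNReal.ofReal (S.flowProb k) • (Measure.dirac k).prod (S.pop k).toMeasure := by
  ext E hE
  have hK : MeasurableSet ({k} ×ˢ Set.univ : Set (Fin M × ℕ)) :=
    (measurableSet_singleton k).prod .univ
  rw [Measure.restrict_apply hE, currentLaw, Measure.finsetSum_apply]
  rw [Finset.sum_eq_single k]
  · simp only [Measure.smul_apply, smul_eq_mul, Measure.dirac_prod]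
    rw [Measure.map_apply measurable_prodMk_left (hE.inter hK),
      Measure.map_apply measurable_prodMk_left hE]
    congr 2
    ext d
    simp
  · intro j _ hj
    simp only [Measure.smul_apply, smul_eq_mul, Measure.dirac_prod]
    rw [Measure.map_apply measurable_prodMk_left (hE.inter hK)]
    have : Prod.mk j ⁻¹' (E ∩ {k} ×ˢ Set.univ) = ∅ := by
      ext d
      simp [hj]
    simp [this]
  · simp

instance : SFinite S.currentLaw := by
  rw [currentLaw]; infer_instance

theorem cond_law (k : Fin M) : cond S.law {ω | flowAtZero ω = k} = S.flowLaw k := by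
  have hset : {ω : Config M | flowAtZero ω = k} = ({k} ×ˢ Set.univ) ×ˢ Set.univ := by
    ext ω; simp [flowAtZero]
  have hν : ENNReal.ofReal (S.flowProb k) ≠ 0 := by
    simpa using S.flowProb_pos k
  have h1 : S.law.restrict {ω | flowAtZero ω = k}
      = ENNReal.ofReal (S.flowProb k) • S.flowLaw k := by
    rw [hset, law, ← Measure.prod_restrict, restrict_currentLaw, Measure.restrict_univ,
      Measure.prod_smul_left]
    rfl
  have h2 : S.law {ω | flowAtZero ω = k} = ENNReal.ofReal (S.flowProb k) := by
    rw [← Measure.restrict_apply_univ, h1]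
    simp
  rw [ProbabilityTheory.cond, h1, h2, smul_smul, ENNReal.inv_mul_cancel hν
    ENNReal.ofReal_ne_top, one_smul]

/-- Given that flow `k` issues the request, the probability that the requested item has not been
requested within a time in which `τ` requests of the mixed flow are expected. -/
def unseenProb (k : Fin M) (τ : ℝ) : ℝ :=
  ∑' d, S.condProb k d * Real.exp (-(τ * S.mixedProb d))

theorem measurableSet_unseen_itemAtZero (t : ℝ) :
    MeasurableSet {ω : Config M | ω.2 ∈ unseen t (itemAtZero ω)} := by
  have h : {ω : Config M | ω.2 ∈ unseen t (itemAtZero ω)}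
      = ⋃ d, {ω | ω.1.2 = d} ∩ {ω | ω.2 ∈ unseen t d} := by
    ext ω; simp [itemAtZero]
  rw [h]
  refine MeasurableSet.iUnion fun d => MeasurableSet.inter ?_ ?_
  · exact (measurable_snd.comp measurable_fst) (measurableSet_singleton d)
  · exact measurable_snd (measurableSet_unseen t d)

theorem flowLaw_unseen (k : Fin M) {t : ℝ} (ht : 0 ≤ t) :
    (S.flowLaw k).real {ω | ω.2 ∈ unseen t (itemAtZero ω)}
      = S.unseenProb k (S.totalRate * t) := by
  have h1 : ∀ d, S.past (unseen t d)
      = ENNReal.ofReal (Real.exp (-(S.totalRate * t * S.mixedProb d))) := fun d => by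
    rw [← S.past_unseen k ht d, ofReal_measureReal]
  have h2 : S.flowLaw k {ω | ω.2 ∈ unseen t (itemAtZero ω)}
      = ∑' d, ENNReal.ofReal (S.condProb k d * Real.exp (-(S.totalRate * t * S.mixedProb d))) := by
    rw [flowLaw, Measure.prod_apply (measurableSet_unseen_itemAtZero t)]
    have h3 : ∀ a : Fin M × ℕ,
        S.past (Prod.mk a ⁻¹' {ω : Config M | ω.2 ∈ unseen t (itemAtZero ω)})
        = ENNReal.ofReal (Real.exp (-(S.totalRate * t * S.mixedProb a.2))) := fun a => h1 a.2
    simp_rw [h3]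
    rw [Measure.dirac_prod, lintegral_map (Measurable.of_discrete) measurable_prodMk_left,
      lintegral_countable']
    refine tsum_congr fun d => ?_
    rw [PMF.toMeasure_apply_singleton _ _ (measurableSet_singleton d), mul_comm,
      ENNReal.ofReal_mul (S.condProb_nonneg k d), condProb,
      ENNReal.ofReal_toReal ((S.pop k).apply_ne_top d)]
  rw [measureReal_def, h2, ENNReal.tsum_toReal_eq fun d => ENNReal.ofReal_ne_top]
  exact tsum_congr fun d => ENNReal.toReal_ofReal
    (mul_nonneg (S.condProb_nonneg k d) (Real.exp_pos _).le)

theorem flowLaw_snd_preimage (k : Fin M) {A : Set (Fin M → ℕ → ℝ × ℕ)} (hA : MeasurableSet A) :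
    (S.flowLaw k).real {ω | ω.2 ∈ A} = S.past.real A := by
  have h : MeasurePreserving Prod.snd (S.flowLaw k) S.past := measurePreserving_snd
  rw [measureReal_def, measureReal_def, ← h.measure_preimage hA.nullMeasurableSet]
  rfl

theorem ofReal_itemSeen (t : ℝ) (d : ℕ) (w : Fin M → ℕ → ℝ × ℕ) [Decidable (w ∈ unseen t d)] :
    ENNReal.ofReal (S.itemSeen t d w) = if w ∈ unseen t d then 0 else ENNReal.ofReal (S.size d) := by
  simp only [itemSeen, Set.indicator_apply]
  split_ifs <;> simp

/-- If the requested item has not been seen for a time `t`, all the items seen within this time are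
in front of it. -/
theorem seenSize_le_searchCost {t : ℝ} (ht : 0 < t) {ω : Config M}
    (h : ω.2 ∈ unseen t (itemAtZero ω)) : S.seenSize t ω.2 ≤ S.searchCost ω := by
  classical
  refine ENNReal.tsum_le_tsum fun d => ?_
  rw [S.ofReal_itemSeen]
  split_ifs with h1 h2 h2
  · exact zero_le
  · exact le_rfl
  · exact le_rfl
  · rw [← ofReal_le_lastAge_iff ht] at h h1
    exact absurd ((not_le.1 h1).trans_le h) h2

/-- If the requested item has been seen within a time `t`, only items seen within this time are in
front of it. -/
theorem searchCost_le_seenSize {t : ℝ} (ht : 0 < t) {ω : Config M}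
    (h : ω.2 ∉ unseen t (itemAtZero ω)) : S.searchCost ω ≤ S.seenSize t ω.2 := by
  classical
  refine ENNReal.tsum_le_tsum fun d => ?_
  rw [S.ofReal_itemSeen]
  split_ifs with h1 h2 h2
  · rw [← ofReal_le_lastAge_iff ht] at h h2
    exact absurd (h1.trans (not_le.1 h)) (not_lt.2 h2)
  · exact le_rfl
  · exact le_rfl
  · exact zero_le

theorem missProb_le (k : Fin M) {t : ℝ} (ht : 0 < t) (x : ℝ) :
    S.missProb k x ≤ S.unseenProb k (S.totalRate * t)
      + S.past.real {w | ENNReal.ofReal x < S.seenSize t w} := by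
  rw [missProb, cond_law, ← S.flowLaw_unseen k ht.le, ← S.flowLaw_snd_preimage k
    (measurableSet_lt measurable_const (S.measurable_seenSize t))]
  refine (measureReal_mono fun ω hω => ?_).trans (measureReal_union_le _ _)
  by_cases h : ω.2 ∈ unseen t (itemAtZero ω)
  · exact Or.inl h
  · exact Or.inr (lt_of_lt_of_le hω (S.searchCost_le_seenSize ht h))

theorem le_missProb (k : Fin M) {t : ℝ} (ht : 0 < t) (x : ℝ) :
    S.unseenProb k (S.totalRate * t) - S.past.real {w | S.seenSize t w ≤ ENNReal.ofReal x}
      ≤ S.missProb k x := by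
  rw [missProb, cond_law, ← S.flowLaw_unseen k ht.le, ← S.flowLaw_snd_preimage k
    (measurableSet_le (S.measurable_seenSize t) measurable_const), sub_le_iff_le_add]
  refine (measureReal_mono fun ω hω => ?_).trans (measureReal_union_le _ _)
  by_cases h : S.seenSize t ω.2 ≤ ENNReal.ofReal x
  · exact Or.inr h
  · exact Or.inl ((not_le.1 h).trans_le (S.seenSize_le_searchCost ht hω))

end CacheSystem

/-! ### The function `m` and its inverse -/

/-- The error of replacing `(1 - p) ^ τ` by `exp (-τ p)` is summable over the items, uniformly
in `τ`. -/
theorem exp_neg_mul_sub_rpow_le {p τ : ℝ} (hp0 : 0 ≤ p) (hp1 : p ≤ 1) (hτ : 1 ≤ τ) :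
    Real.exp (-(τ * p)) - (1 - p) ^ τ ≤ p := by
  have hb : 1 - p ^ 2 ≤ (1 - p) * Real.exp p := by
    nlinarith [Real.add_one_le_exp p]
  have h1 : 1 + τ * (-p ^ 2) ≤ ((1 - p) * Real.exp p) ^ τ := by
    refine (one_add_mul_self_le_rpow_one_add (by nlinarith) hτ).trans ?_
    exact Real.rpow_le_rpow (by nlinarith) (by linarith) (by linarith)
  rw [Real.mul_rpow (by linarith) (Real.exp_pos _).le, ← Real.exp_mul] at h1
  have h2 : Real.exp (-(τ * p)) * Real.exp (p * τ) = 1 := by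
    rw [← Real.exp_add]; simp [mul_comm]
  have h3 := mul_le_mul_of_nonneg_left h1 (Real.exp_pos (-(τ * p))).le
  have h4 : Real.exp (-(τ * p)) * ((1 - p) ^ τ * Real.exp (p * τ)) = (1 - p) ^ τ := by
    rw [mul_left_comm, h2, mul_one]
  rw [h4] at h3
  -- `u exp (-u) ≤ 1` with `u = τ p`
  have h5 : τ * p * Real.exp (-(τ * p)) ≤ 1 := by
    rw [Real.exp_neg, ← div_eq_mul_inv, div_le_one (Real.exp_pos _)]
    linarith [Real.add_one_le_exp (τ * p)]
  have h6 := mul_le_mul_of_nonneg_left h5 hp0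
  nlinarith

namespace CacheSystem

variable {M : ℕ} (S : CacheSystem M)

theorem mixedProb_le_one (k : Fin M) (d : ℕ) : S.mixedProb d ≤ 1 :=
  le_hasSum (S.hasSum_mixedProb k) d fun i _ => S.mixedProb_nonneg i

theorem one_sub_rpow_nonneg (k : Fin M) {z : ℝ} (hz : 0 ≤ z) (d : ℕ) :
    0 ≤ 1 - (1 - S.mixedProb d) ^ z := by
  refine sub_nonneg.2 (Real.rpow_le_one ?_ ?_ hz)
  · linarith [S.mixedProb_le_one k d]
  · linarith [S.mixedProb_nonneg d]

theorem one_sub_rpow_le (k : Fin M) {z : ℝ} (hz : 1 ≤ z) (d : ℕ) :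
    1 - (1 - S.mixedProb d) ^ z ≤ z * S.mixedProb d := by
  have h := one_add_mul_self_le_rpow_one_add
    (show -1 ≤ -S.mixedProb d by linarith [S.mixedProb_le_one k d]) hz
  rw [← sub_eq_add_neg] at h
  linarith

theorem one_sub_rpow_mono (d : ℕ) (hd : S.mixedProb d < 1) {y z : ℝ} (hyz : y ≤ z) :
    1 - (1 - S.mixedProb d) ^ y ≤ 1 - (1 - S.mixedProb d) ^ z := by
  have := Real.rpow_le_rpow_of_exponent_ge (x := 1 - S.mixedProb d)
    (by linarith) (by linarith [S.mixedProb_nonneg d]) hyz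
  linarith

theorem mixedProb_lt_one (hm : Tendsto S.m atTop atTop) (k : Fin M) (d : ℕ) :
    S.mixedProb d < 1 := by
  refine lt_of_le_of_ne (S.mixedProb_le_one k d) fun hd => ?_
  have h0 : ∀ i, i ≠ d → S.mixedProb i = 0 := by
    intro i hi
    have h1 := (S.hasSum_mixedProb k).summable.sum_le_tsum {i, d}
      fun j _ => S.mixedProb_nonneg j
    rw [Finset.sum_pair hi, (S.hasSum_mixedProb k).tsum_eq, hd] at h1
    linarith [S.mixedProb_nonneg i]
  have h1 : ∀ z, 0 < z → S.m z = S.size d := by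
    intro z hz
    rw [m, tsum_eq_single d]
    · rw [hd, sub_self, Real.zero_rpow hz.ne']; ring
    · intro i hi
      rw [h0 i hi]; simp
  obtain ⟨z, hz, hz0⟩ := ((hm.eventually_gt_atTop (S.size d)).and (eventually_gt_atTop 0)).exists
  rw [h1 z hz0] at hz
  exact lt_irrefl _ hz

section Growth

variable {S}

theorem summable_m (hm : Tendsto S.m atTop atTop) (k : Fin M) {z : ℝ} (hz : 0 ≤ z) :
    Summable fun d => S.size d * (1 - (1 - S.mixedProb d) ^ z) := by
  obtain ⟨B, hB1, hB⟩ := S.exists_size_le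
  refine Summable.of_nonneg_of_le
    (fun d => mul_nonneg (S.size_nonneg d) (S.one_sub_rpow_nonneg k hz d)) (fun d => ?_)
    ((S.hasSum_mixedProb k).summable.mul_left (B * (z + 1)))
  have h1 := (S.one_sub_rpow_mono d (S.mixedProb_lt_one hm k d) (by linarith : z ≤ z + 1)).trans
    (S.one_sub_rpow_le k (by linarith) d)
  calc _ ≤ B * ((z + 1) * S.mixedProb d) :=
        mul_le_mul (hB d) h1 (S.one_sub_rpow_nonneg k hz d) (by linarith)
    _ = _ := by ring

theorem exists_size_mixedProb_pos (hm : Tendsto S.m atTop atTop) :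
    ∃ d, 0 < S.size d ∧ 0 < S.mixedProb d := by
  by_contra! hcon
  obtain ⟨z, hz⟩ := (hm.eventually_gt_atTop 0).exists
  have h0 : S.m z = 0 := by
    rw [m, ← tsum_zero]
    refine tsum_congr fun d => ?_
    rcases (S.size_nonneg d).eq_or_lt with h | h
    · rw [← h, zero_mul]
    · have := le_antisymm (hcon d h) (S.mixedProb_nonneg d)
      rw [this]; simp
  linarith

theorem strictMonoOn_m (hm : Tendsto S.m atTop atTop) (k : Fin M) :
    StrictMonoOn S.m (Set.Ici 0) := by
  intro y hy z hz hyz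
  obtain ⟨d, hd1, hd2⟩ := exists_size_mixedProb_pos hm
  refine (summable_m hm k hy).tsum_lt_tsum (i := d) (fun i => ?_) ?_ (summable_m hm k hz)
  · exact mul_le_mul_of_nonneg_left
      (S.one_sub_rpow_mono i (S.mixedProb_lt_one hm k i) hyz.le) (S.size_nonneg i)
  · refine mul_lt_mul_of_pos_left ?_ hd1
    have := Real.rpow_lt_rpow_of_exponent_gt (x := 1 - S.mixedProb d)
      (by linarith [S.mixedProb_lt_one hm k d]) (by linarith) hyz
    linarith

theorem mInv_m (hm : Tendsto S.m atTop atTop) (k : Fin M) {τ : ℝ} (hτ : 0 ≤ τ) :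
    S.mInv (S.m τ) = τ := by
  have : {z | 0 ≤ z ∧ S.m τ ≤ S.m z} = Set.Ici τ := by
    ext z
    refine ⟨fun h => ((strictMonoOn_m hm k).le_iff_le hτ h.1).1 h.2, fun h => ?_⟩
    have hz : 0 ≤ z := hτ.trans h
    exact ⟨hz, ((strictMonoOn_m hm k).le_iff_le hτ hz).2 h⟩
  rw [mInv, this, csInf_Ici]

theorem le_m_of_mInv_lt (hm : Tendsto S.m atTop atTop) (k : Fin M) {x z : ℝ}
    (h : S.mInv x < z) : x ≤ S.m z := by
  have hne : {z | 0 ≤ z ∧ x ≤ S.m z}.Nonempty :=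
    ((eventually_ge_atTop 0).and (hm.eventually_ge_atTop x)).exists
  obtain ⟨w, ⟨hw0, hw⟩, hwz⟩ := exists_lt_of_csInf_lt hne h
  exact hw.trans ((strictMonoOn_m hm k).monotoneOn hw0 (hw0.trans hwz.le : (0 : ℝ) ≤ z) hwz.le)

theorem m_lt_of_lt_mInv {x z : ℝ} (hz : 0 ≤ z) (h : z < S.mInv x) : S.m z < x := by
  by_contra! hcon
  have hbdd : BddBelow {z | 0 ≤ z ∧ x ≤ S.m z} := ⟨0, fun w hw => hw.1⟩
  exact absurd (csInf_le hbdd ⟨hz, hcon⟩) (not_le.2 h)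

theorem tendsto_mInv (hm : Tendsto S.m atTop atTop) (k : Fin M) :
    Tendsto S.mInv atTop atTop := by
  refine tendsto_atTop.2 fun b => ?_
  filter_upwards [eventually_gt_atTop (S.m b)] with x hx
  by_contra! hb
  exact absurd (le_m_of_mInv_lt hm k hb) (not_le.2 hx)

theorem m_le_two_mul (hm : Tendsto S.m atTop atTop) (k : Fin M) {z w : ℝ} (hz : 0 ≤ z)
    (hzw : z ≤ w) (hw : w ≤ 2 * z) : S.m w ≤ 2 * S.m z := by
  have h0 : S.m w ≤ S.m (2 * z) := (strictMonoOn_m hm k).monotoneOn (hz.trans hzw : (0 : ℝ) ≤ w)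
    (by positivity : (0 : ℝ) ≤ 2 * z) hw
  refine h0.trans ?_
  rw [m, m, ← tsum_mul_left]
  refine (summable_m hm k (by positivity)).tsum_le_tsum (fun d => ?_)
    ((summable_m hm k hz).mul_left 2)
  have h1 : (1 - S.mixedProb d) ^ (2 * z) = ((1 - S.mixedProb d) ^ z) ^ 2 := by
    rw [mul_comm, Real.rpow_mul (by linarith [S.mixedProb_le_one k d])]
    norm_num
  rw [h1, mul_left_comm]
  refine mul_le_mul_of_nonneg_left ?_ (S.size_nonneg d)
  nlinarith [sq_nonneg (1 - (1 - S.mixedProb d) ^ z)]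

theorem expectedSeen_le_m (hm : Tendsto S.m atTop atTop) (k : Fin M) {τ : ℝ} (hτ : 0 ≤ τ) :
    S.expectedSeen τ ≤ S.m τ := by
  refine (S.summable_expectedSeen k hτ).tsum_le_tsum (fun d => ?_) (summable_m hm k hτ)
  refine mul_le_mul_of_nonneg_left ?_ (S.size_nonneg d)
  have h1 : (1 - S.mixedProb d) ^ τ ≤ Real.exp (-S.mixedProb d) ^ τ :=
    Real.rpow_le_rpow (by linarith [S.mixedProb_le_one k d])
      (by linarith [Real.add_one_le_exp (-S.mixedProb d)]) hτ
  rw [← Real.exp_mul] at h1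
  have h2 : -S.mixedProb d * τ = -(τ * S.mixedProb d) := by ring
  rw [h2] at h1
  linarith

theorem m_sub_le_expectedSeen (hm : Tendsto S.m atTop atTop) (k : Fin M) {B : ℝ}
    (hB : ∀ d, S.size d ≤ B) {τ : ℝ} (hτ : 1 ≤ τ) : S.m τ - B ≤ S.expectedSeen τ := by
  have hτ0 : 0 ≤ τ := by linarith
  have h1 := ((S.hasSum_mixedProb k).mul_left B)
  rw [mul_one] at h1
  have h2 := ((S.summable_expectedSeen k hτ0).hasSum).add h1
  rw [sub_le_iff_le_add]
  change _ ≤ (∑' d, S.size d * (1 - Real.exp (-(τ * S.mixedProb d)))) + B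
  rw [← h2.tsum_eq]
  refine (summable_m hm k hτ0).tsum_le_tsum (fun d => ?_) h2.summable
  have hp := S.mixedProb_nonneg d
  have h3 := exp_neg_mul_sub_rpow_le hp (S.mixedProb_le_one k d) hτ
  have h4 : S.size d * (Real.exp (-(τ * S.mixedProb d)) - (1 - S.mixedProb d) ^ τ)
      ≤ S.size d * S.mixedProb d := mul_le_mul_of_nonneg_left h3 (S.size_nonneg d)
  have h5 := mul_le_mul_of_nonneg_right (hB d) hp
  nlinarith

theorem tendsto_log_div_m (hm : Tendsto S.m atTop atTop) (k : Fin M) {δ : ℝ → ℝ}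
    (hδ : ∀ x, 0 < x → 0 < δ x ∧ δ x ≤ 1)
    (hlog : Tendsto (fun x => Real.log (S.mInv x) / (δ x ^ 2 * x)) atTop (𝓝 0)) :
    Tendsto (fun τ => Real.log τ / S.m τ) atTop (𝓝 0) := by
  have h1 := hlog.comp hm
  refine squeeze_zero' ?_ ?_ h1
  · filter_upwards [eventually_ge_atTop 1, hm.eventually_gt_atTop 0] with τ h2 h3
    exact div_nonneg (Real.log_nonneg h2) h3.le
  · filter_upwards [eventually_ge_atTop 1, hm.eventually_gt_atTop 0] with τ h2 h3
    simp only [Function.comp]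
    rw [mInv_m hm k (by linarith)]
    obtain ⟨h4, h5⟩ := hδ _ h3
    refine div_le_div_of_nonneg_left (Real.log_nonneg h2) (by positivity) ?_
    exact mul_le_of_le_one_left h3.le (pow_le_one₀ h4.le h5)

/-- A relative increase of `τ` increases `m τ` by more than any multiple of the typical deviation
`√(m τ log τ)`. The growth conditions on the inverse of `m` enter the argument through this
estimate: they allow a relative increase of the size by `ε δ`, and `δ` dominates `√(log τ / m τ)`. -/
theorem eventually_m_add_sqrt_le (hm : Tendsto S.m atTop atTop) (k : Fin M) {δ f : ℝ → ℝ}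
    (hδ : ∀ x, 0 < x → 0 < δ x ∧ δ x ≤ 1)
    (hmInv : ∀ᶠ ε in 𝓝[>] (0 : ℝ),
      Tendsto (fun x => S.mInv ((1 + ε * δ x) * x) / S.mInv x) atTop (𝓝 (f ε)))
    (hf : Tendsto f (𝓝[>] 0) (𝓝 1))
    (hlog : Tendsto (fun x => Real.log (S.mInv x) / (δ x ^ 2 * x)) atTop (𝓝 0))
    {η A : ℝ} (hη : 0 < η) (hA : 0 < A) :
    ∀ᶠ τ in atTop, S.m τ + A * √(S.m τ * Real.log τ) ≤ S.m ((1 + η) * τ) := by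
  obtain ⟨ε, ⟨hε1, hε2⟩, hε⟩ := ((hmInv.and (hf.eventually
    (gt_mem_nhds (by linarith : 1 < 1 + η)))).and self_mem_nhdsWithin).exists
  replace hε : 0 < ε := hε
  have h1 := (hε1.comp hm).eventually (gt_mem_nhds hε2)
  have h2 := (hlog.comp hm).eventually (gt_mem_nhds (by positivity : 0 < (ε / A) ^ 2))
  filter_upwards [h1, h2, eventually_ge_atTop 1, hm.eventually_gt_atTop 0] with τ h3 h4 hτ hmτ
  have hτ0 : 0 < τ := by linarith
  simp only [Function.comp] at h3 h4
  rw [mInv_m hm k hτ0.le] at h3 h4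
  obtain ⟨hδ0, -⟩ := hδ _ hmτ
  rw [div_lt_iff₀ hτ0] at h3
  rw [div_lt_iff₀ (by positivity)] at h4
  set z := S.m τ
  have h5 : (1 + ε * δ z) * z ≤ S.m ((1 + η) * τ) := le_m_of_mInv_lt hm k h3
  have h6 : A * √(z * Real.log τ) ≤ ε * δ z * z := by
    rw [mul_comm, ← le_div_iff₀ hA]
    refine Real.sqrt_le_iff.2 ⟨by positivity, ?_⟩
    calc z * Real.log τ ≤ z * ((ε / A) ^ 2 * (δ z ^ 2 * z)) :=
          mul_le_mul_of_nonneg_left h4.le hmτ.le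
      _ = _ := by ring
  linarith

end Growth

/-! ### The time until a given total size has been requested -/

section Concentration

variable {S}

theorem eventually_sqrt_log_div_m (hm : Tendsto S.m atTop atTop)
    (hlogm : Tendsto (fun τ => Real.log τ / S.m τ) atTop (𝓝 0)) (B : ℝ) :
    ∀ᶠ τ in atTop, 1 ≤ τ ∧ 0 < S.m τ ∧ √(Real.log τ / S.m τ) * B ≤ 1 ∧
      √(Real.log τ / S.m τ) * √(S.m τ * Real.log τ) = Real.log τ ∧
      √(Real.log τ / S.m τ) ^ 2 * S.m τ = Real.log τ := by
  have h1 := (hlogm.sqrt.mul_const B)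
  rw [Real.sqrt_zero, zero_mul] at h1
  filter_upwards [h1.eventually (gt_mem_nhds zero_lt_one), eventually_ge_atTop 1,
    hm.eventually_gt_atTop 0] with τ h2 h3 h4
  have hL := Real.log_nonneg h3
  refine ⟨h3, h4, h2.le, ?_, ?_⟩
  · rw [← Real.sqrt_mul (by positivity)]
    rw [show Real.log τ / S.m τ * (S.m τ * Real.log τ) = Real.log τ ^ 2 by field_simp,
      Real.sqrt_sq hL]
  · rw [Real.sq_sqrt (by positivity)]
    field_simp

/-- In a time in which `τ` requests are expected, items of total size `m ((1 + η) τ)` have been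
requested with a probability smaller than any power of `τ`. -/
theorem eventually_past_lt_seenSize_le (hm : Tendsto S.m atTop atTop) (k : Fin M)
    (hlogm : Tendsto (fun τ => Real.log τ / S.m τ) atTop (𝓝 0))
    (hgrow : ∀ η A : ℝ, 0 < η → 0 < A →
      ∀ᶠ τ in atTop, S.m τ + A * √(S.m τ * Real.log τ) ≤ S.m ((1 + η) * τ))
    {η K : ℝ} (hη : 0 < η) (hK : 0 < K) :
    ∀ᶠ τ in atTop, ∀ x, S.m ((1 + η) * τ) ≤ x →
      S.past.real {w | ENNReal.ofReal x < S.seenSize (τ / S.totalRate) w} ≤ τ ^ (-K) := by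
  obtain ⟨B, hB1, hB⟩ := S.exists_size_le
  filter_upwards [eventually_sqrt_log_div_m hm hlogm B,
    hgrow η (K + B) hη (by linarith)] with τ ⟨hτ, hmτ, hθB, hθ1, hθ2⟩ hg x hx
  have hΛ := S.totalRate_pos k
  have hτ0 : 0 < τ := by linarith
  -- this choice of the Chernoff parameter balances the two terms of the exponent
  set θ := √(Real.log τ / S.m τ) with hθ
  have hθ0 : 0 ≤ θ := Real.sqrt_nonneg _
  have hL := Real.log_nonneg hτ
  have hx0 : S.m τ + (K + B) * √(S.m τ * Real.log τ) ≤ x := hg.trans hx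
  have hxnn : 0 ≤ x := le_trans (by positivity) hx0
  have h1 := S.past_lt_seenSize_le k (t := τ / S.totalRate) (by positivity) hB hθ0 hθB hxnn
  rw [mul_div_cancel₀ _ hΛ.ne'] at h1
  refine h1.trans ?_
  rw [Real.rpow_def_of_pos hτ0, Real.exp_le_exp]
  have h2 := mul_le_mul_of_nonneg_left hx0 hθ0
  have h3 := mul_le_mul_of_nonneg_left (expectedSeen_le_m hm k hτ0.le)
    (by positivity : 0 ≤ θ + θ ^ 2 * B)
  have h4 : θ * (S.m τ + (K + B) * √(S.m τ * Real.log τ))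
      = θ * S.m τ + (K + B) * Real.log τ := by linear_combination (K + B) * hθ1
  have h5 : (θ + θ ^ 2 * B) * S.m τ = θ * S.m τ + B * Real.log τ := by
    linear_combination B * hθ2
  nlinarith

/-- In a time in which `(1 + η) τ` requests are expected, items of total size at most `m τ` have been
requested with a probability smaller than any power of `τ`. -/
theorem eventually_past_seenSize_le_le (hm : Tendsto S.m atTop atTop) (k : Fin M)
    (hlogm : Tendsto (fun τ => Real.log τ / S.m τ) atTop (𝓝 0))
    (hgrow : ∀ η A : ℝ, 0 < η → 0 < A →
      ∀ᶠ τ in atTop, S.m τ + A * √(S.m τ * Real.log τ) ≤ S.m ((1 + η) * τ))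
    {η K : ℝ} (hη : 0 < η) (hη1 : η ≤ 1) (hK : 0 < K) :
    ∀ᶠ τ in atTop, ∀ x, 0 ≤ x → x ≤ S.m τ →
      S.past.real {w | S.seenSize ((1 + η) * τ / S.totalRate) w ≤ ENNReal.ofReal x}
        ≤ Real.exp 1 * τ ^ (-K) := by
  obtain ⟨B, hB1, hB⟩ := S.exists_size_le
  filter_upwards [eventually_sqrt_log_div_m hm hlogm B,
    hgrow η (K + 2 * B) hη (by linarith)] with τ ⟨hτ, hmτ, hθB, hθ1, hθ2⟩ hg x hx0 hx
  have hΛ := S.totalRate_pos k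
  have hτ0 : 0 < τ := by linarith
  set θ := √(Real.log τ / S.m τ) with hθ
  have hθ0 : 0 ≤ θ := Real.sqrt_nonneg _
  have hL := Real.log_nonneg hτ
  have h1 := S.past_seenSize_le_le k (t := (1 + η) * τ / S.totalRate) (by positivity)
    hB hθ0 hθB hx0
  rw [mul_div_cancel₀ _ hΛ.ne'] at h1
  refine h1.trans ?_
  rw [Real.rpow_def_of_pos hτ0, ← Real.exp_add, Real.exp_le_exp]
  have hτ2 : τ ≤ (1 + η) * τ := by nlinarith
  have hlow := m_sub_le_expectedSeen hm k hB (hτ.trans hτ2)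
  have hup := (expectedSeen_le_m hm k (by positivity : 0 ≤ (1 + η) * τ)).trans
    (m_le_two_mul hm k hτ0.le hτ2 (by nlinarith))
  set μ := S.expectedSeen ((1 + η) * τ)
  have h2 := mul_le_mul_of_nonneg_left hx hθ0
  have h3 := mul_le_mul_of_nonneg_left (sub_le_iff_le_add.1 hlow |>.trans' hg) hθ0
  have h4 := mul_le_mul_of_nonneg_left hup (by positivity : 0 ≤ θ ^ 2 * B)
  have h5 : θ * (S.m τ + (K + 2 * B) * √(S.m τ * Real.log τ))
      = θ * S.m τ + (K + 2 * B) * Real.log τ := by linear_combination (K + 2 * B) * hθ1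
  have h6 : θ ^ 2 * B * (2 * S.m τ) = 2 * B * Real.log τ := by
    linear_combination 2 * B * hθ2
  nlinarith

end Concentration

/-! ### Asymptotics of the miss probability -/

variable {S}

/-- For `c < 1 < c'` close to `1`, the miss probability lies between the values of `unseenProb` at
`c' * m⁻¹ x` and at `c * m⁻¹ x`, up to negligible errors. -/
theorem tendsto_missProb_mul (hm : Tendsto S.m atTop atTop) (k : Fin M)
    (hlogm : Tendsto (fun τ => Real.log τ / S.m τ) atTop (𝓝 0))
    (hgrow : ∀ η A : ℝ, 0 < η → 0 < A →
      ∀ᶠ τ in atTop, S.m τ + A * √(S.m τ * Real.log τ) ≤ S.m ((1 + η) * τ))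
    {Φ : ℝ → ℝ} {β G : ℝ} (hβ : 0 ≤ β) (hΦ : RegularGrowth Φ β)
    (hW : Tendsto (fun τ => Φ τ * S.unseenProb k τ) atTop (𝓝 G)) :
    Tendsto (fun x => S.missProb k x * Φ (S.mInv x)) atTop (𝓝 G) := by
  have hN := tendsto_mInv hm k
  have hΛ := S.totalRate_pos k
  have hK : 0 < β + 2 := by linarith
  have hsmall : Set.Ioo (0 : ℝ) 1 ∈ 𝓝[>] (0 : ℝ) := Ioo_mem_nhdsGT zero_lt_one
  refine tendsto_order.2 ⟨fun a ha => ?_, fun a ha => ?_⟩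
  · have hlim : Tendsto (fun η : ℝ => G * (((1 + η) * (1 + η)) ^ β)⁻¹) (𝓝[>] 0) (𝓝 G) := by
      have h1 : ContinuousAt (fun η : ℝ => G * (((1 + η) * (1 + η)) ^ β)⁻¹) 0 := by
        refine continuousAt_const.mul (ContinuousAt.inv₀ (ContinuousAt.rpow_const
          (by fun_prop) (Or.inl (by norm_num))) ?_)
        simp
      have h2 := h1.tendsto
      simp only [add_zero, mul_one, Real.one_rpow, inv_one] at h2
      exact h2.mono_left nhdsWithin_le_nhds
    obtain ⟨η, hη, hη0, hη1⟩ := ((hlim.eventually (lt_mem_nhds ha)).and hsmall).exists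
    have h3 := ((hΦ.tendsto_mul_comp_const_mul hW (c := (1 + η) * (1 + η)) (by positivity)).sub
      (hΦ.tendsto_mul_rpow_neg_const_mul (c := 1 + η) (by positivity) (Real.exp 1))).comp hN
    rw [sub_zero] at h3
    have hc : Tendsto (fun x => (1 + η) * S.mInv x) atTop atTop :=
      hN.const_mul_atTop (by positivity)
    filter_upwards [h3.eventually (lt_mem_nhds hη), eventually_ge_atTop 0,
      hN.eventually hΦ.eventually_pos, hN.eventually_gt_atTop 0,
      hc.eventually (eventually_past_seenSize_le_le hm k hlogm hgrow hη0 hη1.le hK)]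
      with x h4 hx h5 h6 h7
    refine h4.trans_le ?_
    simp only [Function.comp]
    have h8 := h7 x hx (le_m_of_mInv_lt hm k (by nlinarith))
    have h9 := S.le_missProb k (t := (1 + η) * ((1 + η) * S.mInv x) / S.totalRate)
      (by positivity) x
    rw [mul_div_cancel₀ _ hΛ.ne', ← mul_assoc] at h9
    rw [← mul_assoc] at h8
    rw [← mul_sub, mul_comm]
    exact mul_le_mul_of_nonneg_right ((sub_le_sub_left h8 _).trans h9) h5.le
  · have hlim : Tendsto (fun η : ℝ => G * ((1 - η) ^ β)⁻¹) (𝓝[>] 0) (𝓝 G) := by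
      have h1 : ContinuousAt (fun η : ℝ => G * ((1 - η) ^ β)⁻¹) 0 := by
        refine continuousAt_const.mul (ContinuousAt.inv₀ (ContinuousAt.rpow_const
          (by fun_prop) (Or.inl (by norm_num))) ?_)
        simp
      have h2 := h1.tendsto
      simp only [sub_zero, Real.one_rpow, inv_one, mul_one] at h2
      exact h2.mono_left nhdsWithin_le_nhds
    obtain ⟨η, hη, hη0, hη1⟩ := ((hlim.eventually (gt_mem_nhds ha)).and hsmall).exists
    have hη2 : 0 < 1 - η := by linarith
    have h3 := ((hΦ.tendsto_mul_comp_const_mul hW hη2).add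
      (hΦ.tendsto_mul_rpow_neg_const_mul hη2 1)).comp hN
    rw [add_zero] at h3
    have hc : Tendsto (fun x => (1 - η) * S.mInv x) atTop atTop := hN.const_mul_atTop hη2
    filter_upwards [h3.eventually (gt_mem_nhds hη), hN.eventually hΦ.eventually_pos,
      hN.eventually_gt_atTop 0,
      hc.eventually (eventually_past_lt_seenSize_le hm k hlogm hgrow hη0 hK)] with x h4 h5 h6 h7
    refine lt_of_le_of_lt ?_ h4
    simp only [Function.comp, one_mul]
    have h8 := h7 x (m_lt_of_lt_mInv (by positivity) (by nlinarith [mul_pos hη0 hη0])).le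
    have h9 := S.missProb_le k (t := (1 - η) * S.mInv x / S.totalRate) (by positivity) x
    rw [mul_div_cancel₀ _ hΛ.ne'] at h9
    rw [← mul_add, mul_comm]
    exact mul_le_mul_of_nonneg_left (h9.trans (add_le_add_right h8 _)) h5.le

theorem tendsto_mul_unseenProb {k : Fin M} {e : ℕ → ℕ} (he : S.IsRanking k e)
    (hclass : Tendsto (fun n => S.condProb k (e n) / S.condProb k (e (n + 1))) atTop (𝓝 1))
    {Φ : ℝ → ℝ} {β : ℝ} (hβ : 0 ≤ β) (hΦg : RegularGrowth Φ β)
    (hΦ : (fun y : ℕ => (∑' i, S.condProb k (e (y + i)))⁻¹)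
      ~[atTop] fun y : ℕ => Φ ((S.mixedProb (e y))⁻¹)) :
    Tendsto (fun τ => Φ τ * S.unseenProb k τ) atTop (𝓝 (Real.Gamma (β + 1))) := by
  have hq0 : ∀ n, 0 ≤ S.condProb k (e n) := fun n => S.condProb_nonneg k _
  have hqs : Summable fun n => S.condProb k (e n) :=
    (S.hasSum_condProb k).summable.comp_injective he.injective
  have hps : Summable fun n => S.mixedProb (e n) :=
    (S.hasSum_mixedProb k).summable.comp_injective he.injective
  have hp0 : ∀ n, 0 < S.mixedProb (e n) := by
    intro n
    have hne := eventually_ne_zero_of_tendsto_div_succ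
      (q := fun n => S.condProb k (e n)) hclass
    obtain ⟨N, hN, hnN⟩ := (hne.and (eventually_ge_atTop n)).exists
    have hqN : 0 < S.condProb k (e N) := lt_of_le_of_ne (hq0 N) hN.symm
    refine lt_of_lt_of_le ?_ (he.antitone hnN)
    exact Finset.sum_pos' (fun j _ => mul_nonneg (S.flowProb_pos j).le (S.condProb_nonneg j _))
      ⟨k, Finset.mem_univ k, mul_pos (S.flowProb_pos k) hqN⟩
  have h := tendsto_mul_tsum_exp (q := fun n => S.condProb k (e n))
    (p := fun n => S.mixedProb (e n)) hβ hΦg hq0 hqs hclass he.antitone hp0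
    hps.tendsto_atTop_zero hΦ
  refine h.congr fun τ => ?_
  congr 1
  refine he.injective.tsum_eq
    (f := fun d => S.condProb k d * Real.exp (-(τ * S.mixedProb d))) fun d hd => ?_
  refine he.support_subset ((S.pop k).mem_support_iff d |>.2 fun h0 => hd ?_)
  simp [condProb, h0]

end CacheSystem

end

theorem theorem1 {M : ℕ} (S : CacheSystem M)
    (hm : Tendsto S.m atTop atTop)
    -- the growth conditions on the inverse of `m`
    (δ f : ℝ → ℝ)
    (hδ : ∀ x, 0 < x → 0 < δ x ∧ δ x ≤ 1)
    (hmInv : ∀ᶠ ε in 𝓝[>] (0 : ℝ),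
      Tendsto (fun x => S.mInv ((1 + ε * δ x) * x) / S.mInv x) atTop (𝓝 (f ε)))
    (hf : Tendsto f (𝓝[>] 0) (𝓝 1))
    (hδ_osc : ∀ᶠ ε in 𝓝[>] (0 : ℝ), ∃ h₁ h₂ h₃ h₄ x₀ : ℝ,
      0 < h₁ ∧ h₁ < h₂ ∧ 0 < h₃ ∧ h₃ < h₄ ∧ ∀ x, x₀ < x →
        h₁ < δ x / δ (x + ε * δ x) ∧ δ x / δ (x + ε * δ x) < h₂ ∧
        h₃ < δ (x - ε * δ x) / δ x ∧ δ (x - ε * δ x) / δ x < h₄)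
    (hlog : Tendsto (fun x => Real.log (S.mInv x) / (δ x ^ 2 * x)) atTop (𝓝 0))
    -- the conditions on flow `k`, whose items are `e 0, e 1, …`
    (k : Fin M) (e : ℕ → ℕ) (he : S.IsRanking k e)
    (hclass : Tendsto (fun n => S.condProb k (e n) / S.condProb k (e (n + 1))) atTop (𝓝 1))
    (Φ l : ℝ → ℝ) (β : ℝ) (hβ : 0 ≤ β)
    (hΦ : (fun y : ℕ => (∑' i, S.condProb k (e (y + i)))⁻¹)
      ~[atTop] fun y : ℕ => Φ ((S.mixedProb (e y))⁻¹))
    (hl : SlowlyVarying l)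
    (hΦl : Φ ~[atTop] fun x => x ^ β * l x)
    (hβ_zero : β = 0 → ∃ x₀, MonotoneOn l (Set.Ici x₀)) :
    (fun x => S.missProb k x) ~[atTop] fun x => Real.Gamma (β + 1) / Φ (S.mInv x) := by
  have hΦg : RegularGrowth Φ β := RegularGrowth.of_isEquivalent hβ hl hΦl hβ_zero
  have hΓ : 0 < Real.Gamma (β + 1) := Real.Gamma_pos_of_pos (by linarith)
  have hlim := CacheSystem.tendsto_missProb_mul hm k
    (CacheSystem.tendsto_log_div_m hm k hδ hlog)
    (fun η A hη hA => CacheSystem.eventually_m_add_sqrt_le hm k hδ hmInv hf hlog hη hA) hβ hΦg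
    (CacheSystem.tendsto_mul_unseenProb he hclass hβ hΦg hΦ)
  have hpos := (CacheSystem.tendsto_mInv hm k).eventually hΦg.eventually_pos
  rw [isEquivalent_iff_tendsto_one (hpos.mono fun x hx => (div_pos hΓ hx).ne')]
  have h := hlim.div_const (Real.Gamma (β + 1))
  rw [div_self hΓ.ne'] at h
  refine h.congr' (hpos.mono fun x hx => ?_)
  simp only [Pi.div_apply]
  rw [div_div_eq_mul_div]
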